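/- **Theorem 5 (Rate of CD$_q$).** Let $A,E,\beta,\gamma>0$ (peak intensity, average intensity, bias, scaling), $Q(x)=\frac1{\sqrt{2\pi}}\int_x^\infty e^{-u^2/2}\,du$, $\bar\epsilon=2Q(\beta)$, $N=\lceil\log_2(\gamma(A+2\beta))\rceil$, and $1\le q\le N-1$. *Channel.* In each channel use the input is $x=(X_0^b,\dots,X_{N-1}^b)\in\{0,1\}^N$. The noise vector $(Z_0^b,\dots,Z_{N-1}^b)$ is independent of the input and has the law $$P\{Z^b=z\}=\frac1T\sum_{k}\Big[Q\big(\tfrac{k-\gamma\beta}{\gamma}\big)-Q\big(\tfrac{k+1-\gamma\beta}{\gamma}\big)\Big],$$ where the sum is over the integers $-\lceil\gamma A\rceil\le k\le\lceil\gamma(A+2\beta)\rceil-1$ whose $N$-bit representation (that of $2^N+k$ if $k<0$; least significant bit first) is $z$, and $T=Q\big(\tfrac{-\lceil\gamma A\rceil-\gamma\beta}{\gamma}\big)-Q\big(\tfrac{\lceil\gamma(A+2\beta)\rceil-\gamma\beta}{\gamma}\big)$. The carry-over bits are $W_0^b=0$, $W_{i+1}^b=(X_i^bZ_i^b+X_i^bW_i^b+Z_i^bW_i^b)\bmod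 2$. Given the input $x$, the whole output is erased with probability $e(x)$, independently of the noise; here $e$ is any function with $0\le e(x)\le\bar\epsilon$ for all $x$ with $\sum_i x_i2^i\le\gamma A$ (the case $e\equiv\bar\epsilon$ is the vector binary channel VBC$_{\bar\epsilon}$). The output is $Y_i^c=\xi$ for all $i$ if erased, and $Y_i^c=(X_i^b+Z_i^b+W_i^b)\bmod 2$, $0\le i\le N-1$, otherwise; $Y_i^c=0$ for $i\ge N$. The channel is memoryless. Put $\bar Y_i^c=(Y_i^c+W_i^b)\bmod2$ if $Y_i^c\ne\xi$, and $\bar Y_i^c=\xi$ otherwise. *Scheme CD$_q$.* The message is split into $m_0,\dots,m_{N-1}$, and $m_i$ is encoded by a separate binary block code of length $n$ on bit-pipe $i$. Only bit-pipes from a set $\mathcal V$ with $\sum_{i\in\mathcal V}2^i\le\gamma A$ are used (the others send $0$), and every transmitted block satisfies $\frac1n\sum_t\sum_iX_i^b(t)2^i\le\gamma E$. The receiver decodes $m_0,m_1,\dots,m_{N-1}$ in this order; $m_i$ is decoded from $(\bar Y_i^c(t),Y_{i+1}^c(t),\dots,Y_{i+q}^c(t))$, $t=1,\dots,n$, only,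 with the carry-over bits in $\bar Y_i^c$ computed from the messages decoded before. The scheme achieves the rate $R$ if for every $\delta>0$ and all large $n$ there is such a code with total rate at least $R-\delta$ bits per channel use and with probability at most $\delta$ (uniform messages) that some message is decoded wrongly. *Claim.* The CD$_q$ scheme achieves the rate $$R_{\mathrm{CD}_q}=(1-\bar\epsilon)\,\max_{p}\ \sum_{i=0}^{N-1} I\big(X_i^b;\bar Y_i^c,Y_{i+1}^c,\dots,Y_{i+q}^c\,\big|\,\bar Y_i^c\ne\xi\big),$$ where the mutual information (in bits) is computed, conditionally on the event $\bar Y_i^c\ne\xi$, for independent input bits $X_j^b\sim\mathrm{Bern}(p_j)$, and the maximum, which exists, is over $p\in[0,1]^N$ with $\sum_{i:\,p_i>0}2^i\le\gamma A$ and $\sum_{i:\,p_i>0}p_i2^i\le\gamma E$. -/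

import Mathlib

namespace VBC

noncomputable section

/-! ### Mutual information on a finite probability space (in bits) -/

/-- Probability of the event `{f = a}` under the weights `μ`. -/
def prob {Ω α : Type*} [Fintype Ω] [DecidableEq α] (μ : Ω → ℝ) (f : Ω → α) (a : α) : ℝ :=
  ∑ ω with f ω = a, μ ω

/-- Mutual information `I(f; g)`, in bits, of two finitely valued random variables under `μ`
(terms of probability zero contribute zero). -/
def mutualInfo {Ω α α' : Type*} [Fintype Ω] [Fintype α] [Fintype α'] [DecidableEq α]
    [DecidableEq α'] (μ : Ω → ℝ) (f : Ω → α) (g : Ω → α') : ℝ :=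
  ∑ a, ∑ b, prob μ (fun ω => (f ω, g ω)) (a, b) *
    Real.logb 2 (prob μ (fun ω => (f ω, g ω)) (a, b) / (prob μ f a * prob μ g b))

/-- The law `μ` conditioned on the event `S`. -/
def condLaw {Ω : Type*} [Fintype Ω] (μ : Ω → ℝ) (S : Ω → Prop) [DecidablePred S] : Ω → ℝ :=
  fun ω => if S ω then μ ω / ∑ ω' with S ω', μ ω' else 0

/-! ### The vector binary channel with erasures -/

/-- Standard Gaussian tail function `Q`. -/
def gaussQ (x : ℝ) : ℝ :=
  (1 / Real.sqrt (2 * Real.pi)) * ∫ u in Set.Ioi x, Real.exp (-u ^ 2 / 2)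

/-- The `N`-bit representation of the integer `k`, two's complement (`2^N + k`) for `k < 0`;
index `0` is the least significant bit. -/
def bits (N : ℕ) (k : ℤ) : Fin N → Bool :=
  fun i => decide (((if k < 0 then 2 ^ N + k else k) / 2 ^ (i : ℕ)) % 2 = 1)

/-- `P{γ(Z+β) ∈ [k,k+1)}` for standard Gaussian `Z`. -/
def cellMass (β γ : ℝ) (k : ℤ) : ℝ :=
  gaussQ ((k - γ * β) / γ) - gaussQ ((k + 1 - γ * β) / γ)

/-- Joint law of the noise bits `(Z_0, …, Z_{N-1})`: the Gaussian mass of all cells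
`[k, k+1)`, `-⌈γA⌉ ≤ k ≤ ⌈γ(A+2β)⌉ - 1`, whose label is `z`, normalized. -/
def noiseProb (N : ℕ) (A β γ : ℝ) (z : Fin N → Bool) : ℝ :=
  (∑ k ∈ Finset.Ico (-⌈γ * A⌉) ⌈γ * (A + 2 * β)⌉ with bits N k = z, cellMass β γ k) /
    (gaussQ ((-⌈γ * A⌉ - γ * β) / γ) - gaussQ ((⌈γ * (A + 2 * β)⌉ - γ * β) / γ))

/-- Extension of a bit vector by zeros. -/
def ext {N : ℕ} (x : Fin N → Bool) (i : ℕ) : Bool :=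
  if h : i < N then x ⟨i, h⟩ else false

/-- The carry-over bit of a binary addition, out of the two summand bits and the incoming carry. -/
def carryBit (x z w : Bool) : Bool := (x && z) ^^ (x && w) ^^ (z && w)

/-- The carry-over bits `W_i`. -/
def carry {N : ℕ} (x z : Fin N → Bool) : ℕ → Bool
  | 0 => false
  | i + 1 => carryBit (ext x i) (ext z i) (carry x z i)

/-- The intensity level `∑ x_i 2^i` of an input vector. -/
def level {N : ℕ} (x : Fin N → Bool) : ℝ := ∑ i : Fin N, if x i then (2 : ℝ) ^ (i : ℕ) else 0

/-- What the channel draws in one use: the noise vector and whether the output is erased. -/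
abbrev State (N : ℕ) := (Fin N → Bool) × Bool

/-- Probability of the state `(z, erased?)` given the input vector `x`. The noise is independent
of the input, and the erasure occurs with conditional probability `e x`. -/
def stateProb {N : ℕ} (A β γ : ℝ) (e : (Fin N → Bool) → ℝ) (x : Fin N → Bool) (s : State N) : ℝ :=
  noiseProb N A β γ s.1 * (if s.2 then e x else 1 - e x)

/-- The channel output: `Y_i = X_i + Z_i + W_i mod 2` on every bit-pipe if the channel use is not
erased, and the erasure symbol `none` on every bit-pipe otherwise. -/
def output {N : ℕ} (x : Fin N → Bool) (s : State N) : Fin N → Option Bool :=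
  fun i => if s.2 then none else some (x i ^^ s.1 i ^^ carry x s.1 i)

/-- The outputs with `Y_i = 0` for `i > N - 1`. -/
def outputExt {N : ℕ} (y : Fin N → Option Bool) (i : ℕ) : Option Bool :=
  if h : i < N then y ⟨i, h⟩ else some false

/-! ### The rate expression -/

/-- Law of an input vector with independent `Bern(p_i)` bits. -/
def inputProb {N : ℕ} (p : Fin N → ℝ) (x : Fin N → Bool) : ℝ :=
  ∏ i, if x i then p i else 1 - p i

/-- Joint law of the input vector and the channel state. -/
def jointLaw {N : ℕ} (A β γ : ℝ) (e : (Fin N → Bool) → ℝ) (p : Fin N → ℝ) :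
    (Fin N → Bool) × State N → ℝ :=
  fun ω => inputProb p ω.1 * stateProb A β γ e ω.1 ω.2

/-- The tuple `(Ȳ_i, Y_{i+1}, …, Y_{i+q})`, where `Ȳ_i = Y_i + W_i mod 2` if `Y_i` is not erased,
and `Ȳ_i` is the erasure symbol otherwise. -/
def cdObs {N : ℕ} (q : ℕ) (i : Fin N) (ω : (Fin N → Bool) × State N) :
    Fin (q + 1) → Option Bool :=
  Fin.cons ((output ω.1 ω.2 i).map fun b => b ^^ carry ω.1 ω.2.1 i)
    fun j : Fin q => outputExt (output ω.1 ω.2) (i + (j + 1))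

/-- `I(X_i; Ȳ_i, Y_{i+1}, …, Y_{i+q} | Ȳ_i ≠ ξ)`: mutual information under the law conditioned on
the event that `Ȳ_i` is not erased. -/
def cdInfo {N : ℕ} (A β γ : ℝ) (e : (Fin N → Bool) → ℝ) (q : ℕ) (p : Fin N → ℝ)
    (i : Fin N) : ℝ :=
  mutualInfo (condLaw (jointLaw A β γ e p) fun ω => cdObs q i ω 0 ≠ none)
    (fun ω => ω.1 i) (cdObs q i)

/-- The parameters `p` allowed by the peak and average constraints; the bit-pipes with `p_i > 0`
are `on`. -/
def Feasible {N : ℕ} (A E γ : ℝ) (p : Fin N → ℝ) : Prop :=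
  (∀ i, 0 ≤ p i ∧ p i ≤ 1) ∧
  ∑ i with 0 < p i, (2 : ℝ) ^ (i : ℕ) ≤ γ * A ∧
  ∑ i with 0 < p i, p i * (2 : ℝ) ^ (i : ℕ) ≤ γ * E

/-! ### Carry-over-assisted decoding -/

/-- A block code of length `n` for the scheme: message set `Fin (M i)`, a separate encoder and a
decoder for each bit-pipe. The decoder of bit-pipe `i` sees the `n` tuples
`(Ȳ_i(t), Y_{i+1}(t), …, Y_{i+q}(t))` and nothing else. -/
structure CDCode (N q n : ℕ) where
  M : Fin N → ℕ
  M_pos : ∀ i, 0 < M i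
  enc : ∀ i, Fin (M i) → Fin n → Bool
  dec : ∀ i, (Fin n → Fin (q + 1) → Option Bool) → Fin (M i)

/-- The carry-over bits as the receiver computes them from an output vector `y` and decoded input
bits `x`: it recovers the noise bit `Y_i + X_i + W_i mod 2` and carries on. The bit with index `i`
depends on `x` and `y` at indices below `i` only. (Used at non-erased times only.) -/
def rxCarry {N : ℕ} (x : Fin N → Bool) (y : Fin N → Option Bool) : ℕ → Bool
  | 0 => false
  | i + 1 => carryBit (ext x i)
      (((outputExt y i).getD false ^^ rxCarry x y i) ^^ ext x i) (rxCarry x y i)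

/-- The input of the decoder of bit-pipe `i`, at one time, computed from the output vector `y` and
the decoded bits `x` of the lower bit-pipes. -/
def rxObs {N : ℕ} (q : ℕ) (i : Fin N) (x : Fin N → Bool) (y : Fin N → Option Bool) :
    Fin (q + 1) → Option Bool :=
  Fin.cons ((y i).map fun b => b ^^ rxCarry x y i)
    fun j : Fin q => outputExt y (i + (j + 1))

namespace CDCode

variable {N q n : ℕ}

/-- A tuple of messages, one for each bit-pipe. -/
abbrev Msg (c : CDCode N q n) := ∀ i, Fin (c.M i)

/-- The input vector sent at time `t` for the message tuple `m`. -/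
def word (c : CDCode N q n) (m : c.Msg) (t : Fin n) : Fin N → Bool := fun i => c.enc i (m i) t

/-- The estimates after the bit-pipes `0, …, k-1` have been decoded, in this order, each one with
the carry-over bits computed from the messages decoded before (the later entries are
placeholders). -/
def decodeUpTo (c : CDCode N q n) (y : Fin n → Fin N → Option Bool) : ℕ → c.Msg
  | 0 => fun i => ⟨0, c.M_pos i⟩
  | k + 1 =>
    if h : k < N then
      Function.update (decodeUpTo c y k) ⟨k, h⟩
        (c.dec ⟨k, h⟩ fun t => rxObs q ⟨k, h⟩ (c.word (decodeUpTo c y k) t) (y t))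
    else decodeUpTo c y k

/-- The decoded message tuple. -/
def decode (c : CDCode N q n) (y : Fin n → Fin N → Option Bool) : c.Msg := c.decodeUpTo y N

/-- Probability that some message is decoded wrongly, for uniformly distributed messages over `n`
uses of the memoryless channel. -/
def errorProb (c : CDCode N q n) (A β γ : ℝ) (e : (Fin N → Bool) → ℝ) : ℝ :=
  (∑ m : c.Msg, ∑ s : Fin n → State N,
    if c.decode (fun t => output (c.word m t) (s t)) = m then 0
    else ∏ t, stateProb A β γ e (c.word m t) (s t)) / ∏ i, (c.M i : ℝ)

/-- The input constraints. Only bit-pipes from a set `V` with `∑_{i ∈ V} 2^i ≤ γA` are used, which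
gives the peak constraint at every time, and every transmitted block meets the average
constraint. -/
def Admissible (c : CDCode N q n) (A E γ : ℝ) : Prop :=
  (∃ V : Finset (Fin N), ∑ i ∈ V, (2 : ℝ) ^ (i : ℕ) ≤ γ * A ∧
    ∀ i ∉ V, c.M i = 1 ∧ ∀ m t, c.enc i m t = false) ∧
  ∀ m : c.Msg, ∑ t, level (c.word m t) ≤ n * (γ * E)

end CDCode

/-- The scheme achieves the total rate `r` (in bits per channel use): for every `δ > 0` and all
large block lengths there is a code of total rate at least `r - δ` with error probability at most
`δ`. -/
def CDAchieves {N : ℕ} (A E β γ : ℝ) (e : (Fin N → Bool) → ℝ) (q : ℕ) (r : ℝ) : Prop :=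
  ∀ δ : ℝ, 0 < δ → ∀ᶠ n : ℕ in Filter.atTop, ∃ c : CDCode N q n,
    c.Admissible A E γ ∧ n * (r - δ) ≤ ∑ i, Real.logb 2 (c.M i) ∧ c.errorProb A β γ e ≤ δ

end

end VBC

namespace VBC

/-! ### The Gaussian tail function -/

/-! The proof is a random coding argument carried out bit-pipe by bit-pipe. If every decoder would
succeed when given the true carry-over bits, then successive decoding succeeds: correct lower
messages yield the correct carries, by induction on the bit-pipe (`CDCode.decode_eq`). Hence the
error event is covered by separate failures of the individual bit-pipes, although all of them share
the same noise and erasures.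

On bit-pipe `i` the codewords are i.i.d. `Bern(p i)`, and the decoder compares a product of
likelihood ratios `condScore` with a threshold `2 ^ (n θ)`. The ratio comes from the law given
non-erasure and equals 1 at erased times. Its mean logarithm is at least `(1 - ε) * cdInfo`
(`mul_mutualInfo_condLaw_le`), so the true codeword fails with exponentially small probability
(`exists_chernoff`). Its mean under an independent codeword bit is at most 1, so by Markov's
inequality a wrong codeword passes with probability at most `2 ^ (-n θ)` (`sum_block_score_le`). A
union bound then allows every rate below `θ`.

For the average constraint, codebooks are drawn with a slightly shrunk `p'` and overweight words are
replaced by zero words; continuity of the rate in `p` makes the loss arbitrarily small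
(`exists_shrink`). The same continuity and compactness of the feasible set give the maximum. Erasure
probabilities above the peak intensity play no role, since neither feasible laws nor admissible
codes use such inputs. -/

theorem integrable_exp_neg_sq_div_two :
    MeasureTheory.Integrable fun u : ℝ => Real.exp (-u ^ 2 / 2) := by
  have h := integrable_exp_neg_mul_sq (b := 1 / 2) (by norm_num)
  refine h.congr (Filter.Eventually.of_forall fun u => ?_)
  simp only
  congr 1
  ring

theorem gaussQ_strictAnti : StrictAnti gaussQ := by
  intro a b hab
  have hi := integrable_exp_neg_sq_div_two
  have h := intervalIntegral.integral_Ioi_sub_Ioi (a := a) (b := b) hi.integrableOn hab.le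
  have hpos : 0 < ∫ u in a..b, Real.exp (-u ^ 2 / 2) :=
    intervalIntegral.intervalIntegral_pos_of_pos hi.intervalIntegrable
      (fun u => Real.exp_pos _) hab
  have hc : (0 : ℝ) < 1 / Real.sqrt (2 * Real.pi) := by positivity
  unfold gaussQ
  exact mul_lt_mul_of_pos_left (by linarith) hc

theorem gaussQ_zero : gaussQ 0 = 1 / 2 := by
  have h := integral_gaussian_Ioi (1 / 2)
  have h2 : ∫ u in Set.Ioi (0 : ℝ), Real.exp (-u ^ 2 / 2) = Real.sqrt (2 * Real.pi) / 2 := by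
    rw [show 2 * Real.pi = Real.pi / (1 / 2) by ring, ← h]
    congr 1
    ext u
    congr 1
    ring
  have h3 : Real.sqrt (2 * Real.pi) ≠ 0 := by positivity
  rw [gaussQ, h2]
  field_simp

/-- Non-erasure thus has positive probability, which conditioning on it requires. -/
theorem two_mul_gaussQ_lt_one {β : ℝ} (hβ : 0 < β) : 2 * gaussQ β < 1 := by
  have h := gaussQ_strictAnti hβ
  rw [gaussQ_zero] at h
  linarith

/-! ### The laws of noise, state and input -/

theorem sum_Ico_int_sub (F : ℤ → ℝ) {a b : ℤ} (hab : a ≤ b) :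
    ∑ k ∈ Finset.Ico a b, (F k - F (k + 1)) = F a - F b := by
  induction b, hab using Int.leInduction with
  | base => simp
  | succ n hn ih =>
    have h : Finset.Ico a (n + 1) = insert n (Finset.Ico a n) := by
      ext k
      simp only [Finset.mem_Ico, Finset.mem_insert]
      omega
    rw [h, Finset.sum_insert (by simp), ih]
    ring

section Noise

variable {A β γ : ℝ}

theorem neg_ceil_lt_ceil (hA : 0 < A) (hβ : 0 < β) (hγ : 0 < γ) :
    -⌈γ * A⌉ < ⌈γ * (A + 2 * β)⌉ := by
  have h1 : 0 < ⌈γ * A⌉ := Int.ceil_pos.2 (by positivity)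
  have h2 : 0 < ⌈γ * (A + 2 * β)⌉ := Int.ceil_pos.2 (by positivity)
  omega

theorem noise_total_pos (hA : 0 < A) (hβ : 0 < β) (hγ : 0 < γ) :
    0 < gaussQ ((-⌈γ * A⌉ - γ * β) / γ) - gaussQ ((⌈γ * (A + 2 * β)⌉ - γ * β) / γ) := by
  have h : ((-⌈γ * A⌉ : ℤ) : ℝ) < ⌈γ * (A + 2 * β)⌉ := by
    exact_mod_cast neg_ceil_lt_ceil hA hβ hγ
  push_cast at h
  exact sub_pos.2 (gaussQ_strictAnti (by gcongr))

theorem cellMass_nonneg (hγ : 0 < γ) (k : ℤ) : 0 ≤ cellMass β γ k := by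
  refine sub_nonneg.2 (gaussQ_strictAnti.antitone ?_)
  gcongr
  linarith

theorem noiseProb_nonneg (N : ℕ) (hA : 0 < A) (hβ : 0 < β) (hγ : 0 < γ) (z : Fin N → Bool) :
    0 ≤ noiseProb N A β γ z :=
  div_nonneg (Finset.sum_nonneg fun k _ => cellMass_nonneg hγ k) (noise_total_pos hA hβ hγ).le

theorem sum_noiseProb (N : ℕ) (hA : 0 < A) (hβ : 0 < β) (hγ : 0 < γ) :
    ∑ z, noiseProb N A β γ z = 1 := by
  unfold noiseProb
  -- The labels partition the cells whether or not distinct cells have distinct labels; the cell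
  -- masses then telescope.
  rw [← Finset.sum_div, Finset.sum_fiberwise]
  have h := sum_Ico_int_sub (fun k : ℤ => gaussQ ((k - γ * β) / γ))
    (neg_ceil_lt_ceil hA hβ hγ).le
  push_cast at h
  unfold cellMass
  rw [h]
  exact div_self (noise_total_pos hA hβ hγ).ne'

end Noise

/-- A binary probability mass function. -/
def bern (p : ℝ) (x : Bool) : ℝ := if x then p else 1 - p

theorem bern_nonneg {p : ℝ} (h : 0 ≤ p ∧ p ≤ 1) (x : Bool) : 0 ≤ bern p x := by
  cases x <;> simp [bern, h.1, h.2]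

theorem sum_bern (p : ℝ) : ∑ x, bern p x = 1 := by simp [bern]

theorem inputProb_eq {N : ℕ} (p : Fin N → ℝ) (x : Fin N → Bool) :
    inputProb p x = ∏ i, bern (p i) (x i) := rfl

theorem inputProb_nonneg {N : ℕ} {p : Fin N → ℝ} (h : ∀ i, 0 ≤ p i ∧ p i ≤ 1)
    (x : Fin N → Bool) : 0 ≤ inputProb p x :=
  Finset.prod_nonneg fun i _ => bern_nonneg (h i) (x i)

theorem sum_inputProb {N : ℕ} (p : Fin N → ℝ) : ∑ x, inputProb p x = 1 := by
  simp only [inputProb_eq]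
  rw [← Fintype.prod_sum (fun i x => bern (p i) x)]
  exact Finset.prod_eq_one fun i _ => sum_bern (p i)

section State

variable {N : ℕ} {A β γ : ℝ} {e : (Fin N → Bool) → ℝ}

theorem stateProb_nonneg (hA : 0 < A) (hβ : 0 < β) (hγ : 0 < γ)
    (he : ∀ x, 0 ≤ e x ∧ e x ≤ 1) (x : Fin N → Bool) (s : State N) :
    0 ≤ stateProb A β γ e x s := by
  refine mul_nonneg (noiseProb_nonneg N hA hβ hγ _) ?_
  split_ifs
  · exact (he x).1
  · linarith [(he x).2]

theorem sum_stateProb (hA : 0 < A) (hβ : 0 < β) (hγ : 0 < γ) (x : Fin N → Bool) :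
    ∑ s, stateProb A β γ e x s = 1 := by
  rw [Fintype.sum_prod_type]
  simp [stateProb, ← mul_add, sum_noiseProb N hA hβ hγ]

theorem jointLaw_nonneg (hA : 0 < A) (hβ : 0 < β) (hγ : 0 < γ)
    (he : ∀ x, 0 ≤ e x ∧ e x ≤ 1) {p : Fin N → ℝ} (hp : ∀ i, 0 ≤ p i ∧ p i ≤ 1)
    (ω : (Fin N → Bool) × State N) : 0 ≤ jointLaw A β γ e p ω :=
  mul_nonneg (inputProb_nonneg hp _) (stateProb_nonneg hA hβ hγ he _ _)

theorem sum_jointLaw (hA : 0 < A) (hβ : 0 < β) (hγ : 0 < γ) (p : Fin N → ℝ) :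
    ∑ ω, jointLaw A β γ e p ω = 1 := by
  rw [Fintype.sum_prod_type]
  simp only [jointLaw]
  simp_rw [← Finset.mul_sum, sum_stateProb hA hβ hγ, mul_one]
  exact sum_inputProb p

theorem cdObs_zero_ne_none_iff {q : ℕ} (i : Fin N) (ω : (Fin N → Bool) × State N) :
    cdObs q i ω 0 ≠ none ↔ ω.2.2 = false := by
  rcases ω with ⟨x, z, b⟩
  cases b <;> simp [cdObs, output]

theorem sum_jointLaw_not_erased (hA : 0 < A) (hβ : 0 < β) (hγ : 0 < γ) (p : Fin N → ℝ)
    (q : ℕ) (i : Fin N) :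
    ∑ ω with cdObs q i ω 0 ≠ none, jointLaw A β γ e p ω = ∑ x, inputProb p x * (1 - e x) := by
  simp_rw [cdObs_zero_ne_none_iff]
  rw [Finset.sum_filter, Fintype.sum_prod_type]
  refine Finset.sum_congr rfl fun x _ => ?_
  rw [Fintype.sum_prod_type]
  simp only [jointLaw, stateProb, Fintype.sum_bool]
  simp [← Finset.mul_sum, ← Finset.sum_mul, sum_noiseProb N hA hβ hγ]

theorem le_sum_jointLaw_not_erased (hA : 0 < A) (hβ : 0 < β) (hγ : 0 < γ) {p : Fin N → ℝ}
    (hp : ∀ i, 0 ≤ p i ∧ p i ≤ 1) {ε : ℝ} (he : ∀ x, e x ≤ ε) (q : ℕ) (i : Fin N) :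
    1 - ε ≤ ∑ ω with cdObs q i ω 0 ≠ none, jointLaw A β γ e p ω := by
  rw [sum_jointLaw_not_erased hA hβ hγ]
  calc 1 - ε = ∑ x, inputProb p x * (1 - ε) := by rw [← Finset.sum_mul, sum_inputProb, one_mul]
    _ ≤ _ := Finset.sum_le_sum fun x _ =>
      mul_le_mul_of_nonneg_left (by linarith [he x]) (inputProb_nonneg hp x)

end State

/-! ### Mutual information -/

section Prob

variable {Ω α α' : Type*} [Fintype Ω] [DecidableEq α] [DecidableEq α'] {μ : Ω → ℝ}

theorem prob_nonneg (hμ : ∀ ω, 0 ≤ μ ω) (f : Ω → α) (a : α) : 0 ≤ prob μ f a :=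
  Finset.sum_nonneg fun ω _ => hμ ω

theorem le_prob (hμ : ∀ ω, 0 ≤ μ ω) (f : Ω → α) (ω : Ω) : μ ω ≤ prob μ f (f ω) :=
  Finset.single_le_sum (f := μ) (fun ω _ => hμ ω) (by simp)

theorem sum_prob_mul [Fintype α] (μ : Ω → ℝ) (f : Ω → α) (F : α → ℝ) :
    ∑ a, prob μ f a * F a = ∑ ω, μ ω * F (f ω) := by
  rw [← Finset.sum_fiberwise Finset.univ f]
  refine Finset.sum_congr rfl fun a _ => ?_
  rw [prob, Finset.sum_mul]
  refine Finset.sum_congr rfl fun ω hω => ?_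
  rw [(Finset.mem_filter.1 hω).2]

theorem sum_prob [Fintype α] (μ : Ω → ℝ) (f : Ω → α) : ∑ a, prob μ f a = ∑ ω, μ ω := by
  simpa using sum_prob_mul μ f fun _ => 1

theorem sum_prob_pair_left [Fintype α] (μ : Ω → ℝ) (f : Ω → α) (g : Ω → α') (b : α') :
    ∑ a, prob μ (fun ω => (f ω, g ω)) (a, b) = prob μ g b := by
  simp only [prob]
  rw [← Finset.sum_fiberwise (Finset.univ.filter fun ω => g ω = b) f]
  refine Finset.sum_congr rfl fun a _ => Finset.sum_congr ?_ fun _ _ => rfl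
  ext ω
  simp [and_comm]

theorem exists_pos_of_prob_pos {f : Ω → α} {a : α} (h : 0 < prob μ f a) :
    ∃ ω, f ω = a ∧ 0 < μ ω := by
  by_contra! hc
  exact h.not_ge (Finset.sum_nonpos fun ω hω => hc ω (by simpa using hω))

theorem continuous_prob (f : Ω → α) (a : α) : Continuous fun μ : Ω → ℝ => prob μ f a :=
  continuous_finsetSum _ fun ω _ => continuous_apply ω

variable [Fintype α] [Fintype α']

theorem mutualInfo_eq_sum (μ : Ω → ℝ) (f : Ω → α) (g : Ω → α') :
    mutualInfo μ f g = ∑ ω, μ ω * Real.logb 2 (prob μ (fun ω => (f ω, g ω)) (f ω, g ω) /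
      (prob μ f (f ω) * prob μ g (g ω))) := by
  rw [mutualInfo, ← Fintype.sum_prod_type', ← sum_prob_mul μ (fun ω => (f ω, g ω))
    fun c => Real.logb 2 (prob μ (fun ω => (f ω, g ω)) c / (prob μ f c.1 * prob μ g c.2))]

/-- Termwise `log x ≥ 1 - 1/x`. Only the total masses are compared, so neither family has to be
normalized. -/
theorem gibbs {ι : Type*} [Fintype ι] {P R : ι → ℝ} (hP : ∀ a, 0 ≤ P a) (hR : ∀ a, 0 ≤ R a)
    (hac : ∀ a, 0 < P a → 0 < R a) (hsum : ∑ a, R a ≤ ∑ a, P a) :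
    0 ≤ ∑ a, P a * Real.logb 2 (P a / R a) := by
  have h2 : 0 < Real.log 2 := Real.log_pos one_lt_two
  have key : ∀ a, (P a - R a) / Real.log 2 ≤ P a * Real.logb 2 (P a / R a) := by
    intro a
    rw [Real.logb, ← mul_div_assoc]
    gcongr
    rcases (hP a).eq_or_lt with h | h
    · simp [← h, hR a]
    · have hr := hac a h
      have := Real.one_sub_inv_le_log_of_pos (div_pos h hr)
      calc P a - R a = P a * (1 - (P a / R a)⁻¹) := by field_simp
        _ ≤ _ := by gcongr
  calc (0 : ℝ) ≤ (∑ a, P a - ∑ a, R a) / Real.log 2 := div_nonneg (by linarith) h2.le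
    _ = ∑ a, (P a - R a) / Real.log 2 := by rw [← Finset.sum_sub_distrib, Finset.sum_div]
    _ ≤ _ := Finset.sum_le_sum fun a _ => key a

theorem mutualInfo_nonneg (hμ : ∀ ω, 0 ≤ μ ω) (h1 : ∑ ω, μ ω = 1) (f : Ω → α) (g : Ω → α') :
    0 ≤ mutualInfo μ f g := by
  rw [mutualInfo, ← Fintype.sum_prod_type']
  refine gibbs (P := fun c : α × α' => prob μ (fun ω => (f ω, g ω)) c)
    (R := fun c => prob μ f c.1 * prob μ g c.2) (fun c => prob_nonneg hμ _ _)
    (fun c => mul_nonneg (prob_nonneg hμ _ _) (prob_nonneg hμ _ _)) ?_ ?_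
  · intro c hc
    obtain ⟨ω, rfl, hω⟩ := exists_pos_of_prob_pos hc
    exact mul_pos (hω.trans_le (le_prob hμ _ _)) (hω.trans_le (le_prob hμ _ _))
  · rw [sum_prob, h1, Fintype.sum_prod_type]
    simp [← Finset.mul_sum, sum_prob, h1]

theorem sum_negMulLog_prob {κ : Type*} [Fintype κ] [DecidableEq κ] (μ : Ω → ℝ) (h : Ω → κ) :
    ∑ a, Real.negMulLog (prob μ h a) = -∑ ω, μ ω * Real.log (prob μ h (h ω)) := by
  rw [← sum_prob_mul μ h fun a => Real.log (prob μ h a), ← Finset.sum_neg_distrib]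
  exact Finset.sum_congr rfl fun a _ => by rw [Real.negMulLog, neg_mul]

theorem mutualInfo_eq_entropy (hμ : ∀ ω, 0 ≤ μ ω) (f : Ω → α) (g : Ω → α') :
    mutualInfo μ f g = (∑ a, Real.negMulLog (prob μ f a) + ∑ b, Real.negMulLog (prob μ g b) -
      ∑ c, Real.negMulLog (prob μ (fun ω => (f ω, g ω)) c)) / Real.log 2 := by
  simp only [sum_negMulLog_prob]
  rw [mutualInfo_eq_sum, sub_neg_eq_add, ← neg_add, neg_add_eq_sub, ← Finset.sum_add_distrib,
    ← Finset.sum_sub_distrib, Finset.sum_div]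
  refine Finset.sum_congr rfl fun ω _ => ?_
  rcases (hμ ω).eq_or_lt with h | h
  · simp [← h]
  · have hf := h.trans_le (le_prob hμ f ω)
    have hg := h.trans_le (le_prob hμ g ω)
    have hfg := h.trans_le (le_prob hμ (fun ω => (f ω, g ω)) ω)
    rw [Real.logb, Real.log_div hfg.ne' (mul_pos hf hg).ne', Real.log_mul hf.ne' hg.ne']
    ring

/-- In the entropy form every term is a continuous `negMulLog`, so vanishing probabilities cause no
trouble. -/
theorem continuousOn_mutualInfo (f : Ω → α) (g : Ω → α') :
    ContinuousOn (fun μ : Ω → ℝ => mutualInfo μ f g) {μ | ∀ ω, 0 ≤ μ ω} := by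
  refine ContinuousOn.congr (Continuous.continuousOn ?_) fun μ hμ => mutualInfo_eq_entropy hμ f g
  exact Continuous.div_const (((continuous_finsetSum _ fun a _ =>
    Real.continuous_negMulLog.comp (continuous_prob f a)).add
      (continuous_finsetSum _ fun b _ => Real.continuous_negMulLog.comp (continuous_prob g b))).sub
        (continuous_finsetSum _ fun c _ => Real.continuous_negMulLog.comp (continuous_prob _ c))) _

end Prob

/-! ### A decoding score out of the conditional law -/

section Score

variable {Ω α α' : Type*} [Fintype Ω]

theorem condLaw_nonneg {μ : Ω → ℝ} (hμ : ∀ ω, 0 ≤ μ ω) (S : Ω → Prop) [DecidablePred S] (ω : Ω) :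
    0 ≤ condLaw μ S ω := by
  unfold condLaw
  split_ifs
  · exact div_nonneg (hμ ω) (Finset.sum_nonneg fun ω _ => hμ ω)
  · exact le_rfl

theorem sum_condLaw {μ : Ω → ℝ} (S : Ω → Prop) [DecidablePred S]
    (h : ∑ ω with S ω, μ ω ≠ 0) : ∑ ω, condLaw μ S ω = 1 := by
  unfold condLaw
  rw [← Finset.sum_filter, ← Finset.sum_div, div_self h]

theorem mul_condLaw {μ : Ω → ℝ} (S : Ω → Prop) [DecidablePred S]
    (h : ∑ ω with S ω, μ ω ≠ 0) {ω : Ω} (hω : S ω) :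
    (∑ ω with S ω, μ ω) * condLaw μ S ω = μ ω := by
  rw [condLaw, if_pos hω, mul_div_cancel₀ _ h]

theorem pos_of_condLaw_pos {μ : Ω → ℝ} (hμ : ∀ ω, 0 ≤ μ ω) {S : Ω → Prop} [DecidablePred S] {ω : Ω}
    (h : 0 < condLaw μ S ω) : 0 < μ ω := by
  refine (hμ ω).lt_of_ne fun h0 => ?_
  simp [condLaw, ← h0] at h

variable [DecidableEq α] [DecidableEq α']

/-- The likelihood ratio used for decoding the value of `f`, of law `P`, from the value of `g`:
on the event `S` it is taken from the law conditioned on `S`, and off `S` it carries no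
information. -/
noncomputable def condScore (μ : Ω → ℝ) (f : Ω → α) (g : Ω → α') (S : α' → Prop) [DecidablePred S]
    (P : α → ℝ) (a : α) (b : α') : ℝ :=
  if S b then prob (condLaw μ fun ω => S (g ω)) (fun ω => (f ω, g ω)) (a, b) /
    (P a * prob (condLaw μ fun ω => S (g ω)) g b) else 1

variable {μ : Ω → ℝ} {f : Ω → α} {g : Ω → α'} {S : α' → Prop} [DecidablePred S] {P : α → ℝ}

theorem condScore_nonneg (hμ : ∀ ω, 0 ≤ μ ω) (hP : ∀ a, 0 ≤ P a) (a : α) (b : α') :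
    0 ≤ condScore μ f g S P a b := by
  have hν := condLaw_nonneg hμ fun ω => S (g ω)
  unfold condScore
  split_ifs
  · exact div_nonneg (prob_nonneg hν _ _) (mul_nonneg (hP a) (prob_nonneg hν _ _))
  · exact zero_le_one

theorem condScore_pos (hμ : ∀ ω, 0 ≤ μ ω) (hc : 0 < ∑ ω with S (g ω), μ ω)
    (hac : ∀ ω, 0 < μ ω → 0 < P (f ω)) {ω : Ω} (hω : 0 < μ ω) :
    0 < condScore μ f g S P (f ω) (g ω) := by
  have hν := condLaw_nonneg hμ fun ω => S (g ω)
  unfold condScore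
  split_ifs with h
  · have hpos : 0 < condLaw μ (fun ω => S (g ω)) ω := by
      rw [condLaw, if_pos h]
      exact div_pos hω hc
    exact div_pos (hpos.trans_le (le_prob hν (fun ω => (f ω, g ω)) ω))
      (mul_pos (hac ω hω) (hpos.trans_le (le_prob hν g ω)))
  · exact zero_lt_one

variable [Fintype α]

/-- Up to terms with `P a = 0`, the left side is a conditional law of `f` given `g = b`. It may be
zero when `b` has no mass, hence an inequality. -/
theorem sum_mul_condScore_le (hμ : ∀ ω, 0 ≤ μ ω) (hP : ∀ a, 0 ≤ P a) (hP1 : ∑ a, P a = 1)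
    (b : α') : ∑ a, P a * condScore μ f g S P a b ≤ 1 := by
  have hν := condLaw_nonneg hμ fun ω => S (g ω)
  unfold condScore
  split_ifs
  · calc _ ≤ ∑ a, prob (condLaw μ fun ω => S (g ω)) (fun ω => (f ω, g ω)) (a, b) /
          prob (condLaw μ fun ω => S (g ω)) g b := by
          refine Finset.sum_le_sum fun a _ => ?_
          rcases (hP a).eq_or_lt with h | h
          · simp only [← h, zero_mul]
            exact div_nonneg (prob_nonneg hν _ _) (prob_nonneg hν _ _)
          · rw [← div_div, div_right_comm, mul_div_cancel₀ _ h.ne']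
      _ ≤ 1 := by
          rw [← Finset.sum_div, sum_prob_pair_left]
          exact div_self_le_one _
  · simp [hP1]

/-- If erasure depends on the input, conditioning on `S` may move the law of `f` away from the
codebook law `P`. Scoring against `P` changes the mean log score, per unit mass of `S`, from the
mutual information to this plus the divergence of the conditional law of `f` from `P`, which is
nonnegative. -/
theorem mul_mutualInfo_condLaw_le [Fintype α'] (hμ : ∀ ω, 0 ≤ μ ω)
    (hc : 0 < ∑ ω with S (g ω), μ ω) (hP : ∀ a, 0 ≤ P a) (hP1 : ∑ a, P a = 1)
    (hac : ∀ ω, 0 < μ ω → 0 < P (f ω)) :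
    (∑ ω with S (g ω), μ ω) * mutualInfo (condLaw μ fun ω => S (g ω)) f g ≤
      ∑ ω, μ ω * Real.logb 2 (condScore μ f g S P (f ω) (g ω)) := by
  set ν := condLaw μ fun ω => S (g ω) with hνdef
  set c := ∑ ω with S (g ω), μ ω with hcdef
  have hν : ∀ ω, 0 ≤ ν ω := condLaw_nonneg hμ _
  have hν1 : ∑ ω, ν ω = 1 := sum_condLaw _ hc.ne'
  have hνμ : ∀ ω, 0 < ν ω → 0 < μ ω := fun ω h => pos_of_condLaw_pos hμ h
  -- The divergence term.
  have hg : 0 ≤ ∑ ω, ν ω * Real.logb 2 (prob ν f (f ω) / P (f ω)) := by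
    rw [← sum_prob_mul ν f fun a => Real.logb 2 (prob ν f a / P a)]
    refine gibbs (fun a => prob_nonneg hν f a) hP ?_ (by rw [sum_prob, hν1, hP1])
    intro a ha
    obtain ⟨ω, rfl, hω⟩ := exists_pos_of_prob_pos ha
    exact hac ω (hνμ ω hω)
  have hterm : ∀ ω, μ ω * Real.logb 2 (condScore μ f g S P (f ω) (g ω)) =
      c * (ν ω * Real.logb 2 (prob ν (fun ω => (f ω, g ω)) (f ω, g ω) /
        (prob ν f (f ω) * prob ν g (g ω))) +
        ν ω * Real.logb 2 (prob ν f (f ω) / P (f ω))) := by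
    intro ω
    by_cases hS : S (g ω)
    · rcases (hν ω).eq_or_lt with h | h
      · have : μ ω = 0 := by
          rw [← mul_condLaw (fun ω => S (g ω)) hc.ne' hS, ← hνdef, ← h, mul_zero]
        simp [this, ← h]
      · have hf := h.trans_le (le_prob hν f ω)
        have hg := h.trans_le (le_prob hν g ω)
        have hfg := h.trans_le (le_prob hν (fun ω => (f ω, g ω)) ω)
        have hPω := hac ω (hνμ ω h)
        rw [← mul_add, ← mul_assoc, mul_condLaw (fun ω => S (g ω)) hc.ne' hS,
          ← Real.logb_mul (by positivity) (by positivity), condScore, if_pos hS]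
        congr 2
        rw [← hνdef]
        field_simp
    · have : ν ω = 0 := by rw [hνdef, condLaw, if_neg hS]
      simp [this, condScore, hS]
  simp only [hterm]
  rw [← Finset.mul_sum, Finset.sum_add_distrib, ← mutualInfo_eq_sum]
  exact mul_le_mul_of_nonneg_left (by linarith) hc.le

end Score

/-! ### The maximum of the rate expression -/

section Max

variable {N : ℕ} {A β γ : ℝ} {e : (Fin N → Bool) → ℝ}

theorem continuous_jointLaw (e : (Fin N → Bool) → ℝ) :
    Continuous fun p : Fin N → ℝ => jointLaw A β γ e p := by
  refine continuous_pi fun ω => Continuous.mul (continuous_finsetProd _ fun i _ => ?_)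
    continuous_const
  split_ifs
  · exact continuous_apply i
  · exact continuous_const.sub (continuous_apply i)

theorem continuousOn_cdInfo (hA : 0 < A) (hβ : 0 < β) (hγ : 0 < γ)
    {ε : ℝ} (hε : ε < 1) (he : ∀ x, 0 ≤ e x ∧ e x ≤ ε) (q : ℕ) (i : Fin N) :
    ContinuousOn (fun p => cdInfo A β γ e q p i) {p | ∀ i, 0 ≤ p i ∧ p i ≤ 1} := by
  have he1 : ∀ x, 0 ≤ e x ∧ e x ≤ 1 := fun x => ⟨(he x).1, (he x).2.trans hε.le⟩
  refine (continuousOn_mutualInfo (fun ω : (Fin N → Bool) × State N => ω.1 i) (cdObs q i)).comp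
    (f := fun p => condLaw (jointLaw A β γ e p) fun ω => cdObs q i ω 0 ≠ none) ?_
    fun p hp ω => condLaw_nonneg (jointLaw_nonneg hA hβ hγ he1 hp) _ ω
  refine continuousOn_pi.2 fun ω => ?_
  unfold condLaw
  split_ifs
  · refine ContinuousOn.div ((continuous_apply ω).comp (continuous_jointLaw e)).continuousOn
      (continuous_finsetSum _ fun ω' _ =>
        (continuous_apply ω').comp (continuous_jointLaw e)).continuousOn fun p hp => ?_
    -- The normalizing denominator stays above `1 - ε > 0`.
    have := le_sum_jointLaw_not_erased hA hβ hγ hp (fun x => (he x).2) q i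
    exact ne_of_gt (lt_of_lt_of_le (by linarith) this)
  · exact continuousOn_const

/-- The support of `p` jumps, so closedness of the peak condition is not immediate. Allowing any `V`
that contains the support writes the set as a finite union of closed sets inside the cube. -/
theorem isCompact_feasible (A E γ : ℝ) : IsCompact {p : Fin N → ℝ | Feasible A E γ p} := by
  have h : {p : Fin N → ℝ | Feasible A E γ p} =
      Set.Icc 0 1 ∩ ⋃ V : Finset (Fin N), {p : Fin N → ℝ | (∑ i ∈ V, (2 : ℝ) ^ (i : ℕ) ≤ γ * A) ∧
        (∀ i, i ∉ V → p i = 0) ∧ ∑ i, p i * (2 : ℝ) ^ (i : ℕ) ≤ γ * E} := by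
    ext p
    simp only [Feasible, Set.mem_ofPred_eq, Set.mem_inter_iff, Set.mem_Icc, Set.mem_iUnion,
      Pi.le_def, Pi.zero_apply, Pi.one_apply, ← forall_and]
    refine and_congr_right fun hp => ?_
    have hz : ∀ i, ¬ 0 < p i → p i = 0 := fun i hi => le_antisymm (not_lt.1 hi) (hp i).1
    have hs : ∑ i with 0 < p i, p i * (2 : ℝ) ^ (i : ℕ) = ∑ i, p i * (2 : ℝ) ^ (i : ℕ) := by
      refine Finset.sum_filter_of_ne fun i _ hi => ?_
      by_contra hc
      exact hi (by rw [hz i hc, zero_mul])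
    rw [hs]
    constructor
    · rintro ⟨h1, h2⟩
      exact ⟨Finset.univ.filter fun i => 0 < p i, h1, fun i hi => hz i (by simpa using hi), h2⟩
    · rintro ⟨V, h1, h2, h3⟩
      refine ⟨le_trans (Finset.sum_le_sum_of_subset_of_nonneg (fun i hi => ?_) fun i _ _ => ?_) h1,
        h3⟩
      · by_contra hc
        exact (Finset.mem_filter.1 hi).2.ne' (h2 i hc)
      · positivity
  rw [h]
  refine isCompact_Icc.inter_right (isClosed_iUnion_of_finite fun V => ?_)
  have hV : IsClosed {p : Fin N → ℝ | ∀ i, i ∉ V → p i = 0} := by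
    simp only [Set.ofPred_forall]
    exact isClosed_iInter fun i => isClosed_iInter fun _ =>
      isClosed_eq (continuous_apply i) continuous_const
  exact isClosed_const.inter (hV.inter (isClosed_le
    (continuous_finsetSum _ fun i _ => (continuous_apply i).mul continuous_const) continuous_const))

theorem exists_isGreatest_cdInfo {E : ℝ} (hA : 0 < A) (hE : 0 ≤ E) (hβ : 0 < β) (hγ : 0 < γ)
    {ε : ℝ} (hε : ε < 1) (he : ∀ x, 0 ≤ e x ∧ e x ≤ ε) (q : ℕ) :
    ∃ p : Fin N → ℝ, Feasible A E γ p ∧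
      ∀ p', Feasible A E γ p' → ∑ i, cdInfo A β γ e q p' i ≤ ∑ i, cdInfo A β γ e q p i := by
  obtain ⟨p, hp, hmax⟩ := (isCompact_feasible (N := N) A E γ).exists_isMaxOn
    ⟨0, by simp [Feasible]; constructor <;> positivity⟩
    (f := fun p => ∑ i, cdInfo A β γ e q p i)
    (continuousOn_finsetSum _ fun i _ =>
      (continuousOn_cdInfo hA hβ hγ hε he q i).mono fun p hp => hp.1)
  exact ⟨p, hp, fun p' hp' => hmax hp'⟩

end Max

/-! ### Product laws -/

theorem sum_prod_pow {Ω : Type*} [Fintype Ω] (g : Ω → ℝ) (n : ℕ) :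
    ∑ ω : Fin n → Ω, ∏ t, g (ω t) = (∑ a, g a) ^ n := by
  rw [← Fintype.prod_sum fun (_ : Fin n) a => g a]
  simp

/-- An exponential bound for the lower deviations of a sum of independent copies. -/
theorem exists_chernoff {Ω : Type*} [Fintype Ω] {μ : Ω → ℝ} (hμ : ∀ ω, 0 ≤ μ ω)
    (h1 : ∑ ω, μ ω = 1) (f : Ω → ℝ) {m : ℝ} (hm : m < ∑ ω, μ ω * f ω) :
    ∃ ρ : ℝ, 0 ≤ ρ ∧ ρ < 1 ∧ ∀ n : ℕ, ∑ ω : Fin n → Ω,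
      (∏ t, μ (ω t)) * (if ∑ t, f (ω t) ≤ n * m then 1 else 0) ≤ ρ ^ n := by
  set φ : ℝ → ℝ := fun l => ∑ ω, μ ω * Real.exp (l * (m - f ω)) with hφ
  have hd : HasDerivAt φ (∑ ω, μ ω * (m - f ω)) 0 := by
    refine HasDerivAt.fun_sum fun ω _ => HasDerivAt.const_mul _ ?_
    simpa using ((hasDerivAt_id (0 : ℝ)).mul_const (m - f ω)).exp
  have hneg : ∑ ω, μ ω * (m - f ω) < 0 := by
    simp only [mul_sub, Finset.sum_sub_distrib, ← Finset.sum_mul, h1, one_mul]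
    linarith
  have h0 : φ 0 = 1 := by simp [hφ, h1]
  -- The function `φ` starts at 1 with negative slope, so it drops below 1 just to the right of 0;
  -- this value is `ρ`.
  obtain ⟨l, hl, hl1⟩ : ∃ l : ℝ, 0 < l ∧ φ l < 1 := by
    have hs := hd.tendsto_slope_zero_right.eventually (gt_mem_nhds hneg)
    obtain ⟨l, hl, hlpos⟩ := (hs.and self_mem_nhdsWithin).exists
    refine ⟨l, hlpos, ?_⟩
    simp only [zero_add, h0, smul_eq_mul] at hl
    by_contra hc
    exact hl.not_ge (mul_nonneg (inv_nonneg.2 (le_of_lt hlpos)) (by linarith))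
  refine ⟨φ l, Finset.sum_nonneg fun ω _ => mul_nonneg (hμ ω) (Real.exp_pos _).le, hl1,
    fun n => ?_⟩
  rw [hφ, ← sum_prod_pow]
  refine Finset.sum_le_sum fun ω _ => ?_
  rw [Finset.prod_mul_distrib, ← Real.exp_sum]
  refine mul_le_mul_of_nonneg_left ?_ (Finset.prod_nonneg fun t _ => hμ _)
  split_ifs with h
  · rw [Real.one_le_exp_iff, ← Finset.mul_sum, Finset.sum_sub_distrib]
    refine mul_nonneg hl.le ?_
    simpa using h
  · exact (Real.exp_pos _).le

/-- Marginalization of a product law to the coordinates in the range of an injective map. -/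
theorem sum_prod_comp_injective {ι κ α : Type*} [Fintype ι] [Fintype κ] [Fintype α]
    [DecidableEq ι] [DecidableEq κ] {w : ι → α → ℝ} (hw : ∀ k, ∑ a, w k a = 1) {σ : κ → ι}
    (hσ : Function.Injective σ) (F : (κ → α) → ℝ) :
    ∑ C : ι → α, (∏ k, w k (C k)) * F (C ∘ σ) = ∑ D : κ → α, (∏ j, w (σ j) (D j)) * F D := by
  classical
  -- Indices outside the range of `σ` are separated off; their weights sum to 1.
  let u : κ ⊕ ↥(Set.range σ)ᶜ ≃ ι :=
    ((Equiv.ofInjective σ hσ).sumCongr (Equiv.refl _)).trans (Equiv.Set.sumCompl (Set.range σ))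
  have hu : ∀ j, u (Sum.inl j) = σ j := fun j => by simp [u]
  let v : (ι → α) ≃ (κ → α) × (↥(Set.range σ)ᶜ → α) :=
    (u.arrowCongr (Equiv.refl α)).symm.trans (Equiv.sumArrowEquivProdArrow _ _ _)
  have hv1 : ∀ C j, (v C).1 j = C (σ j) := fun C j => by simp [v, ← hu]
  have hv2 : ∀ C j, (v C).2 j = C (u (Sum.inr j)) := fun C j => by simp [v]
  calc ∑ C : ι → α, (∏ k, w k (C k)) * F (C ∘ σ)
      = ∑ D : (κ → α) × (↥(Set.range σ)ᶜ → α),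
          ((∏ j, w (σ j) (D.1 j)) * F D.1) * ∏ j, w (u (Sum.inr j)) (D.2 j) := by
        refine Fintype.sum_equiv v _ _ fun C => ?_
        rw [← u.prod_comp, Fintype.prod_sum_type, mul_right_comm]
        have : (v C).1 = C ∘ σ := funext (hv1 C)
        simp only [hv2, this, hu, Function.comp]
    _ = _ := by
        rw [Fintype.sum_prod_type]
        refine Finset.sum_congr rfl fun D _ => ?_
        dsimp only
        rw [← Finset.mul_sum, ← Fintype.prod_sum fun j a => w (u (Sum.inr j)) a]
        simp [hw]

/-! ### Successive decoding with the computed carry-over bits -/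

section Decode

variable {N q n : ℕ}

theorem outputExt_output_not_erased (x z : Fin N → Bool) {j : ℕ} (hj : j < N) :
    outputExt (output x (z, false)) j = some (ext x j ^^ ext z j ^^ carry x z j) := by
  simp [outputExt, output, ext, hj]

/-- Adding the known input bit and the carry to an unerased output bit reveals the noise bit, hence
the next carry. -/
theorem rxCarry_output {x x' z : Fin N → Bool} {k : ℕ} (hk : k ≤ N)
    (h : ∀ j : Fin N, (j : ℕ) < k → x' j = x j) :
    ∀ j ≤ k, rxCarry x' (output x (z, false)) j = carry x z j := by
  intro j
  induction j with
  | zero => exact fun _ => rfl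
  | succ j ih =>
    intro hj
    have hx : ext x' j = ext x j := by
      have hjN : j < N := by omega
      simp only [ext, hjN, dif_pos]
      exact h ⟨j, hjN⟩ (by simpa using hj)
    rw [rxCarry, carry, ih (by omega), outputExt_output_not_erased x z (by omega), hx]
    congr 1
    cases ext x j <;> cases ext z j <;> cases carry x z j <;> rfl

theorem rxObs_eq_cdObs {x x' : Fin N → Bool} {i : Fin N} (h : ∀ j < i, x' j = x j)
    (s : State N) : rxObs q i x' (output x s) = cdObs q i (x, s) := by
  rcases s with ⟨z, b⟩
  unfold rxObs cdObs
  congr 1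
  cases b
  · simp only [rxCarry_output i.2.le (fun j hj => h j hj) i le_rfl]
  · simp [output]

/-- Error propagation needs no separate analysis: at the first bit-pipe decoded wrongly, the
receiver would still have the true carries, contrary to `h`. -/
theorem CDCode.decode_eq (c : CDCode N q n) (m : c.Msg) (s : Fin n → State N)
    (h : ∀ i, c.dec i (fun t => cdObs q i (c.word m t, s t)) = m i) :
    c.decode (fun t => output (c.word m t) (s t)) = m := by
  have key : ∀ k ≤ N, ∀ j : Fin N, (j : ℕ) < k →
      c.decodeUpTo (fun t => output (c.word m t) (s t)) k j = m j := by
    intro k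
    induction k with
    | zero => exact fun _ j hj => absurd hj (Nat.not_lt_zero _)
    | succ k ih =>
      intro hk j hj
      have hkN : k < N := by omega
      rw [CDCode.decodeUpTo, dif_pos hkN]
      rcases Nat.lt_succ_iff_lt_or_eq.1 hj with hlt | heq
      · rw [Function.update_of_ne (by rintro rfl; exact lt_irrefl _ hlt)]
        exact ih (by omega) j hlt
      · obtain rfl : j = ⟨k, hkN⟩ := Fin.ext heq
        rw [Function.update_self, ← h ⟨k, hkN⟩]
        congr 1
        ext1 t
        refine rxObs_eq_cdObs (fun i hi => ?_) (s t)
        simp only [CDCode.word]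
        rw [ih (by omega) i hi]
  exact funext fun j => key N le_rfl j j.2

end Decode

/-! ### Random codebooks -/

section Book

variable {N q n : ℕ} {M : Fin N → ℕ}

/-- The number of ones in a block. -/
noncomputable def weight (c : Fin n → Bool) : ℝ := ∑ t, if c t then 1 else 0

/-- The input vector at time `t`, read off a codebook. -/
def bookWord (C : (Σ i, Fin (M i)) → Fin n → Bool) (m : ∀ i, Fin (M i)) (t : Fin n) :
    Fin N → Bool := fun i => C ⟨i, m i⟩ t

open Classical in
/-- The code out of a codebook: codewords with too many ones are replaced by the zero word, and the
decoder looks for a message with a large score. -/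
noncomputable def thresholdCode (hM : ∀ i, 0 < M i) (C : (Σ i, Fin (M i)) → Fin n → Bool)
    (cap : Fin N → ℝ) (L : Fin N → Bool → (Fin (q + 1) → Option Bool) → ℝ) (τ : Fin N → ℝ) :
    CDCode N q n where
  M := M
  M_pos := hM
  enc i m t := if weight (C ⟨i, m⟩) ≤ n * cap i then C ⟨i, m⟩ t else false
  dec i o := @Classical.epsilon _ ⟨⟨0, hM i⟩⟩ fun m => τ i ≤ ∏ t, L i (C ⟨i, m⟩ t) (o t)

open Classical in
/-- The number of reasons for a decoding error on bit-pipe `i`, when it is decoded with the true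
carry-over bits. -/
noncomputable def failuresAt (C : (Σ i, Fin (M i)) → Fin n → Bool)
    (cap : Fin N → ℝ) (L : Fin N → Bool → (Fin (q + 1) → Option Bool) → ℝ) (τ : Fin N → ℝ)
    (m : ∀ i, Fin (M i)) (s : Fin n → State N) (i : Fin N) : ℝ :=
  (if weight (C ⟨i, m i⟩) ≤ n * cap i then 0 else 1) +
    (if τ i ≤ ∏ t, L i (C ⟨i, m i⟩ t) (cdObs q i (bookWord C m t, s t)) then 0 else 1) +
    ∑ m' with m' ≠ m i,
      if τ i ≤ ∏ t, L i (C ⟨i, m'⟩ t) (cdObs q i (bookWord C m t, s t)) then 1 else 0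

/-- The number of reasons for a decoding error on any bit-pipe. -/
noncomputable def failures (C : (Σ i, Fin (M i)) → Fin n → Bool)
    (cap : Fin N → ℝ) (L : Fin N → Bool → (Fin (q + 1) → Option Bool) → ℝ) (τ : Fin N → ℝ)
    (m : ∀ i, Fin (M i)) (s : Fin n → State N) : ℝ :=
  ∑ i, failuresAt C cap L τ m s i

variable {C : (Σ i, Fin (M i)) → Fin n → Bool} {cap : Fin N → ℝ}
  {L : Fin N → Bool → (Fin (q + 1) → Option Bool) → ℝ} {τ : Fin N → ℝ}
  {m : ∀ i, Fin (M i)} {s : Fin n → State N}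

theorem failuresAt_nonneg (i : Fin N) : 0 ≤ failuresAt C cap L τ m s i := by
  refine add_nonneg (add_nonneg ?_ ?_) (Finset.sum_nonneg fun m' _ => ?_)
  all_goals split_ifs <;> norm_num

theorem failures_nonneg : 0 ≤ failures C cap L τ m s :=
  Finset.sum_nonneg fun i _ => failuresAt_nonneg i

/-- Each reason contributes 1 and none is negative, so a count below 1 means that no reason is
present. -/
theorem of_failures_lt_one (h : failures C cap L τ m s < 1) (i : Fin N) :
    weight (C ⟨i, m i⟩) ≤ n * cap i ∧
    τ i ≤ ∏ t, L i (C ⟨i, m i⟩ t) (cdObs q i (bookWord C m t, s t)) ∧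
    ∀ m', m' ≠ m i → ¬ τ i ≤ ∏ t, L i (C ⟨i, m'⟩ t) (cdObs q i (bookWord C m t, s t)) := by
  classical
  have hi := (Finset.single_le_sum (fun i _ => failuresAt_nonneg i)
    (Finset.mem_univ i)).trans_lt h
  unfold failuresAt at hi
  have h3 : ∀ m' ∈ Finset.univ.filter (fun m' => m' ≠ m i), (0 : ℝ) ≤
      if τ i ≤ ∏ t, L i (C ⟨i, m'⟩ t) (cdObs q i (bookWord C m t, s t)) then 1 else 0 := by
    intro m' _
    split_ifs <;> norm_num
  have h3' := Finset.sum_nonneg h3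
  refine ⟨?_, ?_, fun m' hm' hc => ?_⟩
  · by_contra hc
    rw [if_neg hc] at hi
    split_ifs at hi <;> linarith
  · by_contra hc
    rw [if_neg hc] at hi
    split_ifs at hi <;> linarith
  · have := Finset.single_le_sum h3 (Finset.mem_filter.2 ⟨Finset.mem_univ m', hm'⟩)
    rw [if_pos hc] at this
    split_ifs at hi <;> linarith

theorem decode_thresholdCode (hM : ∀ i, 0 < M i) (h : failures C cap L τ m s < 1) :
    (thresholdCode hM C cap L τ).decode
      (fun t => output ((thresholdCode hM C cap L τ).word m t) (s t)) = m := by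
  have hw : (thresholdCode hM C cap L τ).word m = bookWord C m := by
    funext t i
    simp only [CDCode.word, thresholdCode, bookWord]
    rw [if_pos (of_failures_lt_one h i).1]
  refine CDCode.decode_eq (thresholdCode hM C cap L τ) m s fun i => ?_
  rw [hw]
  obtain ⟨-, h2, h3⟩ := of_failures_lt_one h i
  by_contra hc
  -- The true message passes the threshold, so the choice passes as well; only the true message
  -- does.
  exact h3 _ hc (Classical.epsilon_spec (p := fun m' => τ i ≤ ∏ t, L i (C ⟨i, m'⟩ t) _) ⟨m i, h2⟩)

theorem sum_error_le (hM : ∀ i, 0 < M i) {A β γ : ℝ} {e : (Fin N → Bool) → ℝ} (hA : 0 < A)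
    (hβ : 0 < β) (hγ : 0 < γ) (he : ∀ x, 0 ≤ e x ∧ e x ≤ 1)
    (m : (thresholdCode hM C cap L τ).Msg) :
    (∑ s : Fin n → State N, if (thresholdCode hM C cap L τ).decode
      (fun t => output ((thresholdCode hM C cap L τ).word m t) (s t)) = m then 0
      else ∏ t, stateProb A β γ e ((thresholdCode hM C cap L τ).word m t) (s t)) ≤
    ∑ s : Fin n → State N, (∏ t, stateProb A β γ e (bookWord C m t) (s t)) *
      failures C cap L τ m s := by
  have hnn : ∀ (x : Fin n → Fin N → Bool) (s : Fin n → State N),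
      0 ≤ ∏ t, stateProb A β γ e (x t) (s t) := fun x s =>
    Finset.prod_nonneg fun t _ => stateProb_nonneg hA hβ hγ he _ _
  have hsum : ∀ x : Fin n → Fin N → Bool,
      ∑ s : Fin n → State N, ∏ t, stateProb A β γ e (x t) (s t) = 1 := fun x => by
    rw [← Fintype.prod_sum fun t s => stateProb A β γ e (x t) s]
    exact Finset.prod_eq_one fun t _ => sum_stateProb hA hβ hγ (x t)
  by_cases hcap : ∀ i, weight (C ⟨i, m i⟩) ≤ n * cap i
  · have hw : (thresholdCode hM C cap L τ).word m = bookWord C m := by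
      funext t i
      simp only [CDCode.word, thresholdCode, bookWord]
      rw [if_pos (hcap i)]
    refine Finset.sum_le_sum fun s _ => ?_
    split_ifs with h
    · exact mul_nonneg (hnn _ _) failures_nonneg
    · have h1 : 1 ≤ failures C cap L τ m s := by
        by_contra hc
        exact h (decode_thresholdCode hM (not_le.1 hc))
      rw [hw]
      exact le_mul_of_one_le_right (hnn _ _) h1
  -- With an overweight codeword the sent word differs from the codebook word, and so may the
  -- channel laws. Both have total mass 1, and there is at least one failure in every state, so the
  -- bound survives.
  · calc _ ≤ ∑ s : Fin n → State N,
          ∏ t, stateProb A β γ e ((thresholdCode hM C cap L τ).word m t) (s t) := by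
          refine Finset.sum_le_sum fun s _ => ?_
          split_ifs
          · exact hnn _ _
          · exact le_rfl
      _ = ∑ s : Fin n → State N, ∏ t, stateProb A β γ e (bookWord C m t) (s t) := by
          rw [hsum, hsum]
      _ ≤ _ := by
          refine Finset.sum_le_sum fun s _ => le_mul_of_one_le_right (hnn _ _) ?_
          by_contra hc
          exact hcap fun i => (of_failures_lt_one (not_le.1 hc) i).1

end Book

/-! ### The expected error probability of a random codebook -/

section Average

variable {N q n : ℕ} {A β γ : ℝ} {e : (Fin N → Bool) → ℝ} {p : Fin N → ℝ} {M : Fin N → ℕ}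

/-- Law of a block of independent `Bern(p)` bits. -/
noncomputable def blockProb (p : ℝ) (c : Fin n → Bool) : ℝ := ∏ t, bern p (c t)

theorem sum_blockProb (n : ℕ) (p : ℝ) : ∑ c : Fin n → Bool, blockProb p c = 1 := by
  simp only [blockProb]
  rw [sum_prod_pow, sum_bern, one_pow]

theorem blockProb_nonneg {p : ℝ} (h : 0 ≤ p ∧ p ≤ 1) (c : Fin n → Bool) : 0 ≤ blockProb p c :=
  Finset.prod_nonneg fun _ _ => bern_nonneg h _

/-- Law of a random codebook. -/
noncomputable def bookProb (p : Fin N → ℝ) (C : (Σ i, Fin (M i)) → Fin n → Bool) : ℝ :=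
  ∏ k, blockProb (p k.1) (C k)

theorem bookProb_nonneg (hp : ∀ i, 0 ≤ p i ∧ p i ≤ 1) (C : (Σ i, Fin (M i)) → Fin n → Bool) :
    0 ≤ bookProb p C :=
  Finset.prod_nonneg fun k _ => blockProb_nonneg (hp k.1) _

theorem sum_bookProb : ∑ C : (Σ i, Fin (M i)) → Fin n → Bool, bookProb p C = 1 := by
  simp only [bookProb]
  rw [← Fintype.prod_sum fun (k : Σ i, Fin (M i)) c => blockProb (p k.1) c]
  exact Finset.prod_eq_one fun k _ => sum_blockProb n _

/-- Independent blocks per bit-pipe are, read by time, independent input vectors; the memoryless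
channel then makes the pairs of input and state i.i.d. -/
theorem sum_blocks_states (G : (Fin n → (Fin N → Bool) × State N) → ℝ) :
    ∑ D : Fin N → Fin n → Bool, (∏ i, blockProb (p i) (D i)) *
      ∑ s : Fin n → State N, (∏ t, stateProb A β γ e (fun i => D i t) (s t)) *
        G (fun t => (fun i => D i t, s t)) =
    ∑ ω : Fin n → (Fin N → Bool) × State N, (∏ t, jointLaw A β γ e p (ω t)) * G ω := by
  rw [← (Equiv.arrowProdEquivProdArrow (Fin n) (fun _ => Fin N → Bool)
    (fun _ => State N)).symm.sum_comp, Fintype.sum_prod_type]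
  refine Fintype.sum_equiv (Equiv.piComm fun (_ : Fin N) (_ : Fin n) => Bool) _ _ fun D => ?_
  rw [Finset.mul_sum]
  refine Finset.sum_congr rfl fun s _ => ?_
  simp only [jointLaw, inputProb_eq, blockProb, Finset.prod_mul_distrib]
  rw [Finset.prod_comm, mul_assoc]
  rfl

theorem sum_book_states (m : ∀ i, Fin (M i)) (G : (Fin n → (Fin N → Bool) × State N) → ℝ) :
    ∑ C : (Σ i, Fin (M i)) → Fin n → Bool, bookProb p C *
      ∑ s : Fin n → State N, (∏ t, stateProb A β γ e (bookWord C m t) (s t)) *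
        G (fun t => (bookWord C m t, s t)) =
    ∑ ω : Fin n → (Fin N → Bool) × State N, (∏ t, jointLaw A β γ e p (ω t)) * G ω := by
  rw [← sum_blocks_states]
  have hσ : Function.Injective fun i : Fin N => (⟨i, m i⟩ : Σ i, Fin (M i)) := fun i j h =>
    congrArg Sigma.fst h
  exact sum_prod_comp_injective (w := fun (k : Σ i, Fin (M i)) c => blockProb (n := n) (p k.1) c)
    (fun k => sum_blockProb n _) hσ fun D : Fin N → Fin n → Bool =>
      ∑ s : Fin n → State N, (∏ t, stateProb A β γ e (fun i => D i t) (s t)) *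
        G (fun t => (fun i => D i t, s t))

/-- A competing codeword is independent of the sent ones, hence of the observation. -/
theorem sum_book_states_other (m : ∀ i, Fin (M i)) {i : Fin N} {m' : Fin (M i)} (hm : m' ≠ m i)
    (G : (Fin n → Bool) → (Fin n → (Fin N → Bool) × State N) → ℝ) :
    ∑ C : (Σ i, Fin (M i)) → Fin n → Bool, bookProb p C *
      ∑ s : Fin n → State N, (∏ t, stateProb A β γ e (bookWord C m t) (s t)) *
        G (C ⟨i, m'⟩) (fun t => (bookWord C m t, s t)) =
    ∑ ω : Fin n → (Fin N → Bool) × State N, (∏ t, jointLaw A β γ e p (ω t)) *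
      ∑ c : Fin n → Bool, blockProb (p i) c * G c ω := by
  rw [← sum_blocks_states]
  -- The index `none` stands for the competing codeword, `some j` for the one sent on bit-pipe `j`.
  let σ : Option (Fin N) → Σ i, Fin (M i) := fun o => o.elim ⟨i, m'⟩ fun j => ⟨j, m j⟩
  have hσ : Function.Injective σ := by
    have hne : ∀ j, (⟨i, m'⟩ : Σ i, Fin (M i)) ≠ ⟨j, m j⟩ := by
      intro j h
      obtain rfl : i = j := congrArg Sigma.fst h
      exact hm (by simpa using h)
    rintro (_ | j) (_ | k) h
    · rfl
    · exact absurd h (hne k)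
    · exact absurd h.symm (hne j)
    · exact congrArg some (congrArg Sigma.fst h)
  rw [show ∑ C : (Σ i, Fin (M i)) → Fin n → Bool, bookProb p C *
      ∑ s : Fin n → State N, (∏ t, stateProb A β γ e (bookWord C m t) (s t)) *
        G (C ⟨i, m'⟩) (fun t => (bookWord C m t, s t)) = _ from
    sum_prod_comp_injective (w := fun (k : Σ i, Fin (M i)) c => blockProb (n := n) (p k.1) c)
      (fun k => sum_blockProb n _) hσ fun D : Option (Fin N) → Fin n → Bool =>
        ∑ s : Fin n → State N, (∏ t, stateProb A β γ e (fun i => D (some i) t) (s t)) *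
          G (D none) (fun t => (fun i => D (some i) t, s t))]
  rw [← (Equiv.piOptionEquivProd (β := fun _ : Option (Fin N) => Fin n → Bool)).symm.sum_comp,
    Fintype.sum_prod_type, Finset.sum_comm]
  refine Finset.sum_congr rfl fun D _ => ?_
  simp only [Fintype.prod_option, Finset.mul_sum]
  rw [Finset.sum_comm]
  refine Finset.sum_congr rfl fun s _ => Finset.sum_congr rfl fun c _ => ?_
  simp only [Equiv.piOptionEquivProd, Equiv.coe_fn_symm_mk, σ, Option.elim]
  ring

variable {cap : Fin N → ℝ} {L : Fin N → Bool → (Fin (q + 1) → Option Bool) → ℝ} {τ : Fin N → ℝ}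

/-- Markov's inequality: the mean of the product factors over time, and each factor is at most 1. -/
theorem sum_block_score_le {p : ℝ} (hp : 0 ≤ p ∧ p ≤ 1)
    {L : Bool → (Fin (q + 1) → Option Bool) → ℝ} (hL : ∀ x o, 0 ≤ L x o)
    (hL1 : ∀ o, ∑ x, bern p x * L x o ≤ 1) {τ : ℝ} (hτ : 0 < τ)
    (o : Fin n → Fin (q + 1) → Option Bool) :
    ∑ c : Fin n → Bool, blockProb p c * (if τ ≤ ∏ t, L (c t) (o t) then 1 else 0) ≤ τ⁻¹ := by
  calc _ ≤ ∑ c : Fin n → Bool, τ⁻¹ * ∏ t, (bern p (c t) * L (c t) (o t)) := by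
        refine Finset.sum_le_sum fun c _ => ?_
        rw [Finset.prod_mul_distrib, mul_left_comm]
        refine mul_le_mul_of_nonneg_left ?_ (Finset.prod_nonneg fun _ _ => bern_nonneg hp _)
        split_ifs with h
        · rw [inv_mul_eq_div]
          exact (one_le_div hτ).2 h
        · exact mul_nonneg (inv_nonneg.2 hτ.le) (Finset.prod_nonneg fun _ _ => hL _ _)
    _ = τ⁻¹ * ∏ t, ∑ x, bern p x * L x (o t) := by
        rw [← Finset.mul_sum, Fintype.prod_sum fun t x => bern p x * L x (o t)]
    _ ≤ τ⁻¹ * 1 := by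
        refine mul_le_mul_of_nonneg_left (Finset.prod_le_one (fun t _ => ?_) fun t _ => hL1 _)
          (inv_nonneg.2 hτ.le)
        exact Finset.sum_nonneg fun x _ => mul_nonneg (bern_nonneg hp x) (hL _ _)
    _ = τ⁻¹ := mul_one _

open Classical in
/-- Bound for the expected number of failures on bit-pipe `i`. -/
noncomputable def failureBound (n : ℕ) (A β γ : ℝ) (e : (Fin N → Bool) → ℝ) (p : Fin N → ℝ)
    (M : ℕ) (cap : ℝ) (L : Bool → (Fin (q + 1) → Option Bool) → ℝ) (τ : ℝ) (i : Fin N) : ℝ :=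
  (∑ ω : Fin n → (Fin N → Bool) × State N, (∏ t, jointLaw A β γ e p (ω t)) *
    if weight (fun t => (ω t).1 i) ≤ n * cap then 0 else 1) +
  (∑ ω : Fin n → (Fin N → Bool) × State N, (∏ t, jointLaw A β γ e p (ω t)) *
    if τ ≤ ∏ t, L ((ω t).1 i) (cdObs q i (ω t)) then 0 else 1) + (M - 1) * τ⁻¹

theorem sum_failuresAt_le (hA : 0 < A) (hβ : 0 < β) (hγ : 0 < γ) (he : ∀ x, 0 ≤ e x ∧ e x ≤ 1)
    (hp : ∀ i, 0 ≤ p i ∧ p i ≤ 1) (hL : ∀ i x o, 0 ≤ L i x o)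
    (hL1 : ∀ i o, ∑ x, bern (p i) x * L i x o ≤ 1) (hτ : ∀ i, 0 < τ i) (m : ∀ i, Fin (M i))
    (i : Fin N) :
    ∑ C : (Σ i, Fin (M i)) → Fin n → Bool, bookProb p C *
      ∑ s : Fin n → State N, (∏ t, stateProb A β γ e (bookWord C m t) (s t)) *
        failuresAt C cap L τ m s i ≤
    failureBound n A β γ e p (M i) (cap i) (L i) (τ i) i := by
  classical
  unfold failuresAt failureBound
  simp only [mul_add, Finset.sum_add_distrib]
  refine add_le_add (add_le_add (le_of_eq ?_) (le_of_eq ?_)) ?_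
  · exact sum_book_states (A := A) (β := β) (γ := γ) (e := e) (p := p) m
      fun ω : Fin n → (Fin N → Bool) × State N =>
        if weight (fun t => (ω t).1 i) ≤ n * cap i then 0 else 1
  · exact sum_book_states (A := A) (β := β) (γ := γ) (e := e) (p := p) m
      fun ω : Fin n → (Fin N → Bool) × State N =>
        if τ i ≤ ∏ t, L i ((ω t).1 i) (cdObs q i (ω t)) then 0 else 1
  · have hone : ∑ ω : Fin n → (Fin N → Bool) × State N, ∏ t, jointLaw A β γ e p (ω t) = 1 := by
      rw [sum_prod_pow, sum_jointLaw hA hβ hγ, one_pow]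
    calc _ = ∑ m' with m' ≠ m i, ∑ C : (Σ i, Fin (M i)) → Fin n → Bool, bookProb p C *
          ∑ s : Fin n → State N, (∏ t, stateProb A β γ e (bookWord C m t) (s t)) *
            if τ i ≤ ∏ t, L i (C ⟨i, m'⟩ t) (cdObs q i (bookWord C m t, s t)) then 1 else 0 := by
          simp only [Finset.mul_sum]
          refine Eq.trans (Finset.sum_congr rfl fun C _ => ?_) Finset.sum_comm
          exact Finset.sum_comm
      _ ≤ ∑ m' with m' ≠ m i, (τ i)⁻¹ := by
          refine Finset.sum_le_sum fun m' hm' => ?_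
          rw [sum_book_states_other m (Finset.mem_filter.1 hm').2 fun c ω =>
            if τ i ≤ ∏ t, L i (c t) (cdObs q i (ω t)) then 1 else 0]
          calc _ ≤ ∑ ω : Fin n → (Fin N → Bool) × State N,
                (∏ t, jointLaw A β γ e p (ω t)) * (τ i)⁻¹ :=
                Finset.sum_le_sum fun ω _ => mul_le_mul_of_nonneg_left
                  (by convert sum_block_score_le (hp i) (hL i) (hL1 i) (hτ i) _)
                  (Finset.prod_nonneg fun t _ => jointLaw_nonneg hA hβ hγ he hp _)
            _ = _ := by rw [← Finset.sum_mul, hone, one_mul]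
      _ = _ := by
          rw [Finset.sum_const, nsmul_eq_mul, Finset.filter_ne', Finset.card_erase_of_mem
            (Finset.mem_univ _), Finset.card_univ, Fintype.card_fin, Nat.cast_sub
            (Fin.pos (m i)), Nat.cast_one]

theorem exists_thresholdCode_errorProb_le (hA : 0 < A) (hβ : 0 < β) (hγ : 0 < γ)
    (he : ∀ x, 0 ≤ e x ∧ e x ≤ 1) (hp : ∀ i, 0 ≤ p i ∧ p i ≤ 1) (hL : ∀ i x o, 0 ≤ L i x o)
    (hL1 : ∀ i o, ∑ x, bern (p i) x * L i x o ≤ 1) (hτ : ∀ i, 0 < τ i) (hM : ∀ i, 0 < M i)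
    (n : ℕ) (cap : Fin N → ℝ) :
    ∃ C : (Σ i, Fin (M i)) → Fin n → Bool, (thresholdCode hM C cap L τ).errorProb A β γ e ≤
      ∑ i, failureBound n A β γ e p (M i) (cap i) (L i) (τ i) i := by
  by_contra! hc
  set B := ∑ i, failureBound n A β γ e p (M i) (cap i) (L i) (τ i) i with hB
  have hMpos : 0 < ∏ i, (M i : ℝ) := Finset.prod_pos fun i _ => Nat.cast_pos.2 (hM i)
  have hlt : B < ∑ C : (Σ i, Fin (M i)) → Fin n → Bool,
      bookProb p C * (thresholdCode hM C cap L τ).errorProb A β γ e := by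
    calc B = ∑ C : (Σ i, Fin (M i)) → Fin n → Bool, bookProb p C * B := by
          rw [← Finset.sum_mul, sum_bookProb, one_mul]
      _ < _ := by
          refine Finset.sum_lt_sum (fun C _ =>
            mul_le_mul_of_nonneg_left (hc C).le (bookProb_nonneg hp C)) ?_
          -- Strictness of the average needs a codebook of positive weight.
          obtain ⟨C, hC⟩ : ∃ C : (Σ i, Fin (M i)) → Fin n → Bool, 0 < bookProb p C := by
            by_contra! hC
            have := Finset.sum_nonpos (s := Finset.univ) fun C _ => hC C
            rw [sum_bookProb] at this
            linarith
          exact ⟨C, Finset.mem_univ C, mul_lt_mul_of_pos_left (hc C) hC⟩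
  refine hlt.not_ge ?_
  calc _ ≤ ∑ C : (Σ i, Fin (M i)) → Fin n → Bool, bookProb p C *
        ((∑ m : ∀ i, Fin (M i), ∑ s : Fin n → State N,
          (∏ t, stateProb A β γ e (bookWord C m t) (s t)) * failures C cap L τ m s) /
            ∏ i, (M i : ℝ)) := by
        refine Finset.sum_le_sum fun C _ => mul_le_mul_of_nonneg_left ?_ (bookProb_nonneg hp C)
        exact div_le_div_of_nonneg_right
          (Finset.sum_le_sum fun m _ => sum_error_le hM hA hβ hγ he m) hMpos.le
    _ = (∑ m : ∀ i, Fin (M i), ∑ i, ∑ C : (Σ i, Fin (M i)) → Fin n → Bool, bookProb p C *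
          ∑ s : Fin n → State N, (∏ t, stateProb A β γ e (bookWord C m t) (s t)) *
            failuresAt C cap L τ m s i) / ∏ i, (M i : ℝ) := by
        simp only [← mul_div_assoc, ← Finset.sum_div]
        congr 1
        simp only [Finset.mul_sum, failures]
        rw [Finset.sum_comm]
        refine Finset.sum_congr rfl fun m _ => ?_
        refine Eq.trans (Finset.sum_congr rfl fun C _ => ?_) Finset.sum_comm
        exact Finset.sum_comm
    _ ≤ (∑ m : ∀ i, Fin (M i), B) / ∏ i, (M i : ℝ) := by
        refine div_le_div_of_nonneg_right (Finset.sum_le_sum fun m _ =>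
          Finset.sum_le_sum fun i _ => ?_) hMpos.le
        exact sum_failuresAt_le hA hβ hγ he hp hL hL1 hτ m i
    _ = B := by
        rw [Finset.sum_const, nsmul_eq_mul, Finset.card_univ, Fintype.card_pi]
        simp only [Fintype.card_fin, Nat.cast_prod]
        exact mul_div_cancel_left₀ _ hMpos.ne'

end Average

/-- Bit-pipes with `p i = 0` thus have rate zero, which lets the code give them a single message. -/
theorem mutualInfo_eq_zero_of_const {Ω α α' : Type*} [Fintype Ω] [DecidableEq α] [DecidableEq α']
    [Fintype α] [Fintype α'] {μ : Ω → ℝ} (hμ : ∀ ω, 0 ≤ μ ω) (h1 : ∑ ω, μ ω = 1) {f : Ω → α}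
    (g : Ω → α') {a : α} (hf : ∀ ω, 0 < μ ω → f ω = a) : mutualInfo μ f g = 0 := by
  have hz : ∀ ω, f ω ≠ a → μ ω = 0 := fun ω h =>
    le_antisymm (not_lt.1 fun hp => h (hf ω hp)) (hμ ω)
  rw [mutualInfo_eq_sum]
  refine Finset.sum_eq_zero fun ω _ => ?_
  rcases (hμ ω).eq_or_lt with h | h
  · rw [← h, zero_mul]
  · have hfa : prob μ f a = 1 := by
      rw [prob, Finset.sum_filter_of_ne fun ω _ hω => ?_, h1]
      by_contra hc
      exact hω (hz ω hc)
    have hfg : prob μ (fun ω => (f ω, g ω)) (a, g ω) = prob μ g (g ω) := by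
      simp only [prob, Finset.sum_filter]
      refine Finset.sum_congr rfl fun ω' _ => ?_
      by_cases hc : f ω' = a
      · simp [hc]
      · simp [hc, hz ω' hc]
    rw [hf ω h, hfa, hfg, one_mul, div_self (h.trans_le (le_prob hμ g ω)).ne', Real.logb_one,
      mul_zero]

/-! ### Admissibility of the codes -/

section Admissible

variable {N q n : ℕ} {M : Fin N → ℕ}

theorem sum_level_word (c : CDCode N q n) (m : c.Msg) :
    ∑ t, level (c.word m t) = ∑ i, weight (c.enc i (m i)) * (2 : ℝ) ^ (i : ℕ) := by
  simp only [level, weight, CDCode.word, Finset.sum_mul, ite_mul, one_mul, zero_mul]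
  exact Finset.sum_comm

theorem eq_false_of_weight_nonpos {c : Fin n → Bool} (h : weight c ≤ 0) (t : Fin n) :
    c t = false := by
  by_contra hc
  have := Finset.single_le_sum (f := fun t => if c t then (1 : ℝ) else 0)
    (fun t _ => by split_ifs <;> norm_num) (Finset.mem_univ t)
  rw [Bool.not_eq_false] at hc
  simp only [hc, if_true] at this
  unfold weight at h
  linarith

theorem weight_enc_thresholdCode_le (hM : ∀ i, 0 < M i) (C : (Σ i, Fin (M i)) → Fin n → Bool)
    {cap : Fin N → ℝ} (hcap : ∀ i, 0 ≤ cap i)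
    (L : Fin N → Bool → (Fin (q + 1) → Option Bool) → ℝ) (τ : Fin N → ℝ) (i : Fin N)
    (m : Fin (M i)) : weight ((thresholdCode hM C cap L τ).enc i m) ≤ n * cap i := by
  by_cases h : weight (C ⟨i, m⟩) ≤ n * cap i
  · simp only [thresholdCode, if_pos h]
    exact h
  · simp only [thresholdCode, if_neg h]
    simpa [weight] using mul_nonneg n.cast_nonneg (hcap i)

theorem sum_filter_pos_mul {p : Fin N → ℝ} (hp : ∀ i, 0 ≤ p i) :
    ∑ i with 0 < p i, p i * (2 : ℝ) ^ (i : ℕ) = ∑ i, p i * (2 : ℝ) ^ (i : ℕ) :=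
  Finset.sum_filter_of_ne fun i _ hi => (hp i).lt_of_ne fun h => hi (by rw [← h, zero_mul])

theorem admissible_thresholdCode (hM : ∀ i, 0 < M i) (C : (Σ i, Fin (M i)) → Fin n → Bool)
    {A E γ : ℝ} {p : Fin N → ℝ} (hp : Feasible A E γ p) (hM1 : ∀ i, p i = 0 → M i = 1)
    (L : Fin N → Bool → (Fin (q + 1) → Option Bool) → ℝ) (τ : Fin N → ℝ) :
    (thresholdCode hM C p L τ).Admissible A E γ := by
  have hw := weight_enc_thresholdCode_le hM C (fun i => (hp.1 i).1) L τ
  -- Weight caps `n * p i` on the separate bit-pipes add up to the average constraint for every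
  -- message tuple; a cap of zero forces the zero word.
  refine ⟨⟨Finset.univ.filter fun i => 0 < p i, hp.2.1, fun i hi => ?_⟩, fun m => ?_⟩
  · have h0 : p i = 0 := le_antisymm (by simpa using hi) (hp.1 i).1
    refine ⟨hM1 i h0, fun m t => eq_false_of_weight_nonpos ?_ t⟩
    simpa [h0] using hw i m
  · rw [sum_level_word]
    calc _ ≤ ∑ i, (n * p i) * (2 : ℝ) ^ (i : ℕ) :=
          Finset.sum_le_sum fun i _ => mul_le_mul_of_nonneg_right (hw i (m i)) (by positivity)
      _ = n * ∑ i with 0 < p i, p i * (2 : ℝ) ^ (i : ℕ) := by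
          rw [sum_filter_pos_mul fun i => (hp.1 i).1, Finset.mul_sum]
          simp only [mul_assoc]
      _ ≤ _ := mul_le_mul_of_nonneg_left hp.2.2 n.cast_nonneg

end Admissible

/-! ### Achievability -/

section Achieve

variable {N : ℕ} {A E β γ : ℝ} {e : (Fin N → Bool) → ℝ}

theorem sum_jointLaw_mul_bit (hA : 0 < A) (hβ : 0 < β) (hγ : 0 < γ) (p : Fin N → ℝ) (i : Fin N)
    (F : Bool → ℝ) : ∑ ω, jointLaw A β γ e p ω * F (ω.1 i) = ∑ a, bern (p i) a * F a := by
  have h := sum_prod_comp_injective (w := fun j a => bern (p j) a) (fun j => sum_bern (p j))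
    (σ := fun _ : Unit => i) (fun _ _ _ => rfl) fun D => F (D ())
  rw [Fintype.sum_prod_type]
  simp only [jointLaw]
  simp_rw [mul_right_comm, ← Finset.mul_sum, sum_stateProb hA hβ hγ, mul_one, inputProb_eq]
  refine h.trans ?_
  refine Fintype.sum_equiv (Equiv.funUnique Unit Bool) _ _ fun D => ?_
  simp

theorem bern_pos_of_jointLaw_pos {p : Fin N → ℝ} (hp : ∀ i, 0 ≤ p i ∧ p i ≤ 1) (i : Fin N)
    {ω : (Fin N → Bool) × State N} (h : 0 < jointLaw A β γ e p ω) : 0 < bern (p i) (ω.1 i) := by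
  refine (bern_nonneg (hp i) _).lt_of_ne fun h0 => h.ne' ?_
  rw [jointLaw, inputProb_eq, Finset.prod_eq_zero (Finset.mem_univ i) h0.symm, zero_mul]

theorem eq_false_of_jointLaw_pos {p : Fin N → ℝ} (hp : ∀ i, 0 ≤ p i ∧ p i ≤ 1) {i : Fin N}
    (hi : p i = 0) {ω : (Fin N → Bool) × State N} (h : 0 < jointLaw A β γ e p ω) :
    ω.1 i = false := by
  have := bern_pos_of_jointLaw_pos hp i h
  cases hx : ω.1 i
  · rfl
  · simp [bern, hi, hx] at this

theorem cdInfo_nonneg (hA : 0 < A) (hβ : 0 < β) (hγ : 0 < γ) {ε : ℝ} (hε : ε < 1)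
    (he : ∀ x, 0 ≤ e x ∧ e x ≤ ε) {p : Fin N → ℝ} (hp : ∀ i, 0 ≤ p i ∧ p i ≤ 1) (q : ℕ)
    (i : Fin N) : 0 ≤ cdInfo A β γ e q p i := by
  have hc := le_sum_jointLaw_not_erased hA hβ hγ hp (fun x => (he x).2) q i
  refine mutualInfo_nonneg (condLaw_nonneg (jointLaw_nonneg hA hβ hγ
    (fun x => ⟨(he x).1, (he x).2.trans hε.le⟩) hp) _) (sum_condLaw _ ?_) _ _
  exact ne_of_gt (lt_of_lt_of_le (by linarith) hc)

theorem cdInfo_eq_zero (hA : 0 < A) (hβ : 0 < β) (hγ : 0 < γ) {ε : ℝ} (hε : ε < 1)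
    (he : ∀ x, 0 ≤ e x ∧ e x ≤ ε) {p : Fin N → ℝ} (hp : ∀ i, 0 ≤ p i ∧ p i ≤ 1) (q : ℕ)
    {i : Fin N} (hi : p i = 0) : cdInfo A β γ e q p i = 0 := by
  have hc := le_sum_jointLaw_not_erased hA hβ hγ hp (fun x => (he x).2) q i
  have hμ := jointLaw_nonneg hA hβ hγ (fun x => ⟨(he x).1, (he x).2.trans hε.le⟩) hp
  refine mutualInfo_eq_zero_of_const (condLaw_nonneg hμ _) (sum_condLaw _ ?_) _ (a := false) ?_
  · exact ne_of_gt (lt_of_lt_of_le (by linarith) hc)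
  · exact fun ω hω => eq_false_of_jointLaw_pos hp hi (pos_of_condLaw_pos hμ hω)

theorem exists_weight_bound (hA : 0 < A) (hβ : 0 < β) (hγ : 0 < γ) (he : ∀ x, 0 ≤ e x ∧ e x ≤ 1)
    {p : Fin N → ℝ} (hp : ∀ i, 0 ≤ p i ∧ p i ≤ 1) (i : Fin N) {cap : ℝ}
    (hcap : p i < cap ∨ p i = 0 ∧ cap = 0) :
    ∃ ρ : ℝ, 0 ≤ ρ ∧ ρ < 1 ∧ ∀ n : ℕ,
      ∑ ω : Fin n → (Fin N → Bool) × State N, (∏ t, jointLaw A β γ e p (ω t)) *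
        (if weight (fun t => (ω t).1 i) ≤ n * cap then 0 else 1) ≤ ρ ^ n := by
  have hμ := jointLaw_nonneg hA hβ hγ he hp
  rcases hcap with hcap | ⟨hpi, rfl⟩
  · obtain ⟨ρ, h0, h1, h⟩ := exists_chernoff hμ (sum_jointLaw hA hβ hγ p)
      (fun ω => -(if ω.1 i then 1 else 0)) (m := -cap) (by
        rw [sum_jointLaw_mul_bit hA hβ hγ p i fun a => -(if a then 1 else 0)]
        simpa [bern] using hcap)
    refine ⟨ρ, h0, h1, fun n => le_trans (Finset.sum_le_sum fun ω _ => ?_) (h n)⟩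
    refine mul_le_mul_of_nonneg_left ?_ (Finset.prod_nonneg fun _ _ => hμ _)
    rw [Finset.sum_neg_distrib, mul_neg]
    have hw : weight (fun t => (ω t).1 i) = ∑ t, if (ω t).1 i then (1 : ℝ) else 0 := rfl
    rw [hw]
    split_ifs <;> linarith
  · refine ⟨0, le_rfl, one_pos, fun n => le_of_eq_of_le (Finset.sum_eq_zero fun ω _ => ?_)
      (pow_nonneg le_rfl n)⟩
    by_cases hz : ∀ t, 0 < jointLaw A β γ e p (ω t)
    · have hx : ∀ t, (ω t).1 i = false := fun t => eq_false_of_jointLaw_pos hp hpi (hz t)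
      simp [weight, hx]
    · push Not at hz
      obtain ⟨t, ht⟩ := hz
      rw [Finset.prod_eq_zero (Finset.mem_univ t) (le_antisymm ht (hμ _)), zero_mul]

theorem exists_score_bound {Ω : Type*} [Fintype Ω] {μ : Ω → ℝ} (hμ : ∀ ω, 0 ≤ μ ω)
    (h1 : ∑ ω, μ ω = 1) {s : Ω → ℝ} (hs : ∀ ω, 0 < μ ω → 0 < s ω) {θ : ℝ}
    (hθ : θ < ∑ ω, μ ω * Real.logb 2 (s ω)) :
    ∃ ρ : ℝ, 0 ≤ ρ ∧ ρ < 1 ∧ ∀ n : ℕ, ∑ ω : Fin n → Ω, (∏ t, μ (ω t)) *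
      (if (2 : ℝ) ^ (n * θ) ≤ ∏ t, s (ω t) then 0 else 1) ≤ ρ ^ n := by
  obtain ⟨ρ, h0, h1, h⟩ := exists_chernoff hμ h1 (fun ω => Real.logb 2 (s ω)) hθ
  refine ⟨ρ, h0, h1, fun n => le_trans (Finset.sum_le_sum fun ω _ => ?_) (h n)⟩
  by_cases hz : ∀ t, 0 < μ (ω t)
  · refine mul_le_mul_of_nonneg_left ?_ (Finset.prod_nonneg fun _ _ => hμ _)
    have hpos : 0 < ∏ t, s (ω t) := Finset.prod_pos fun t _ => hs _ (hz t)
    have hiff := Real.le_logb_iff_rpow_le (x := n * θ) one_lt_two hpos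
    rw [← Real.logb_prod _ _ fun t _ => (hs _ (hz t)).ne']
    split_ifs with h2 h3 h3
    · exact zero_le_one
    · exact le_rfl
    · exact le_rfl
    · exact absurd (not_le.1 fun h => h2 (hiff.1 h)).le h3
  -- Where the score might vanish the product law is zero, so the value of the logarithm there is
  -- irrelevant.
  · push Not at hz
    obtain ⟨t, ht⟩ := hz
    rw [Finset.prod_eq_zero (Finset.mem_univ t) (le_antisymm ht (hμ _)), zero_mul, zero_mul]

theorem tendsto_failureBound (hA : 0 < A) (hβ : 0 < β) (hγ : 0 < γ) {ε : ℝ} (hε : ε < 1)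
    (he : ∀ x, 0 ≤ e x ∧ e x ≤ ε) {p : Fin N → ℝ} (hp : ∀ i, 0 ≤ p i ∧ p i ≤ 1) (q : ℕ)
    (i : Fin N) {cap : ℝ} (hcap : p i < cap ∨ p i = 0 ∧ cap = 0) {R θ : ℝ} (hRθ : R < θ)
    (hθ : θ < (1 - ε) * cdInfo A β γ e q p i) :
    Filter.Tendsto (fun n : ℕ => failureBound n A β γ e p ⌈(2 : ℝ) ^ (n * R)⌉₊ cap
      (condScore (jointLaw A β γ e p) (fun ω => ω.1 i) (cdObs q i) (fun o => o 0 ≠ none)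
        (bern (p i))) ((2 : ℝ) ^ (n * θ)) i) Filter.atTop (nhds 0) := by
  have he1 : ∀ x, 0 ≤ e x ∧ e x ≤ 1 := fun x => ⟨(he x).1, (he x).2.trans hε.le⟩
  have hμ := jointLaw_nonneg hA hβ hγ he1 hp
  have hc := le_sum_jointLaw_not_erased hA hβ hγ hp (fun x => (he x).2) q i
  have hc0 : 0 < ∑ ω with cdObs q i ω 0 ≠ none, jointLaw A β γ e p ω :=
    lt_of_lt_of_le (by linarith) hc
  have hac : ∀ ω, 0 < jointLaw A β γ e p ω → 0 < bern (p i) (ω.1 i) := fun ω =>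
    bern_pos_of_jointLaw_pos hp i
  have hinfo := mul_mutualInfo_condLaw_le (f := fun ω : (Fin N → Bool) × State N => ω.1 i)
    (g := cdObs q i) (S := fun o => o 0 ≠ none) hμ hc0 (bern_nonneg (hp i)) (sum_bern _) hac
  -- Nonnegativity of the information allows the actual non-erasure probability to be replaced by
  -- its lower bound.
  have hle : (1 - ε) * cdInfo A β γ e q p i ≤ (∑ ω with cdObs q i ω 0 ≠ none,
      jointLaw A β γ e p ω) * cdInfo A β γ e q p i :=
    mul_le_mul_of_nonneg_right hc (cdInfo_nonneg hA hβ hγ hε he hp q i)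
  obtain ⟨ρ₁, h10, h11, h1⟩ := exists_weight_bound hA hβ hγ he1 hp i hcap
  obtain ⟨ρ₂, h20, h21, h2⟩ := exists_score_bound hμ (sum_jointLaw hA hβ hγ p)
    (fun ω hω => condScore_pos (f := fun ω : (Fin N → Bool) × State N => ω.1 i)
      (g := cdObs q i) (S := fun o => o 0 ≠ none) hμ hc0 hac hω)
    (hθ.trans_le (hle.trans hinfo))
  have h30 : (0 : ℝ) ≤ 2 ^ (R - θ) := by positivity
  have h31 : (2 : ℝ) ^ (R - θ) < 1 := Real.rpow_lt_one_of_one_lt_of_neg one_lt_two (by linarith)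
  have hlim := ((tendsto_pow_atTop_nhds_zero_of_lt_one h10 h11).add
    (tendsto_pow_atTop_nhds_zero_of_lt_one h20 h21)).add
    (tendsto_pow_atTop_nhds_zero_of_lt_one h30 h31)
  rw [add_zero, add_zero] at hlim
  have hM1 : ∀ n : ℕ, (1 : ℝ) ≤ ⌈(2 : ℝ) ^ (n * R)⌉₊ := fun n => by
    exact_mod_cast Nat.ceil_pos.2 (by positivity : (0 : ℝ) < 2 ^ (n * R))
  refine squeeze_zero (fun n => ?_) (fun n => ?_) hlim
  · refine add_nonneg (add_nonneg ?_ ?_) (mul_nonneg (by linarith [hM1 n]) (by positivity))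
    all_goals
      refine Finset.sum_nonneg fun ω _ => mul_nonneg (Finset.prod_nonneg fun _ _ => hμ _) ?_
      split_ifs <;> norm_num
  · refine add_le_add (add_le_add ?_ ?_) ?_
    · convert h1 n
    · convert h2 n
    -- The `M - 1` of the union bound absorbs the rounding up of the number of messages.
    · have hM2 := Nat.ceil_lt_add_one (by positivity : (0 : ℝ) ≤ 2 ^ (n * R))
      calc _ ≤ (2 : ℝ) ^ (n * R) * ((2 : ℝ) ^ (n * θ))⁻¹ :=
            mul_le_mul_of_nonneg_right (by linarith) (by positivity)
        _ = _ := by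
            rw [← Real.rpow_neg two_pos.le, ← Real.rpow_add two_pos, ← Real.rpow_natCast,
              ← Real.rpow_mul two_pos.le]
            congr 1
            ring

/-- Scaling by `l < 1` close to 1 leaves a strict gap between mean weight and cap, as the Chernoff
bound demands. Coordinates equal to zero leave no gap but need none. -/
theorem exists_shrink (hA : 0 < A) (hβ : 0 < β) (hγ : 0 < γ) {ε : ℝ} (hε : ε < 1)
    (he : ∀ x, 0 ≤ e x ∧ e x ≤ ε) {p : Fin N → ℝ} (hp : ∀ i, 0 ≤ p i ∧ p i ≤ 1) (q : ℕ)
    {δ : ℝ} (hδ : 0 < δ) :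
    ∃ p' : Fin N → ℝ, (∀ i, 0 ≤ p' i ∧ p' i ≤ 1) ∧ (∀ i, p' i < p i ∨ p' i = 0 ∧ p i = 0) ∧
      ∑ i, cdInfo A β γ e q p i - δ < ∑ i, cdInfo A β γ e q p' i := by
  have hcont : ContinuousOn (fun l : ℝ => ∑ i, cdInfo A β γ e q (l • p) i) (Set.Icc 0 1) := by
    refine (continuousOn_finsetSum _ fun i _ => continuousOn_cdInfo hA hβ hγ hε he q i).comp
      (f := fun l : ℝ => l • p) (by fun_prop) fun l hl i => ?_
    exact ⟨mul_nonneg hl.1 (hp i).1, mul_le_one₀ hl.2 (hp i).1 (hp i).2⟩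
  have hmem := (hcont 1 ⟨zero_le_one, le_rfl⟩).mono (Set.Ico_subset_Icc_self)
  have hev := hmem.eventually (lt_mem_nhds
    (show ∑ i, cdInfo A β γ e q p i - δ < ∑ i, cdInfo A β γ e q ((1 : ℝ) • p) i by
      rw [one_smul]; linarith))
  have : (nhdsWithin (1 : ℝ) (Set.Ico 0 1)).NeBot := by
    rw [nhdsWithin_Ico_eq_nhdsLT one_pos]
    infer_instance
  obtain ⟨l, hl, hl01⟩ := (hev.and self_mem_nhdsWithin).exists
  refine ⟨l • p, fun i => ⟨mul_nonneg hl01.1 (hp i).1,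
    mul_le_one₀ hl01.2.le (hp i).1 (hp i).2⟩, fun i => ?_, hl⟩
  rcases (hp i).1.eq_or_lt with h | h
  · exact Or.inr ⟨by simp [← h], h.symm⟩
  · exact Or.inl (mul_lt_of_lt_one_left h hl01.2)

theorem cdAchieves_of_feasible (hA : 0 < A) (hβ : 0 < β) (hγ : 0 < γ) {ε : ℝ} (hε0 : 0 ≤ ε)
    (hε : ε < 1) (he : ∀ x, 0 ≤ e x ∧ e x ≤ ε) {p : Fin N → ℝ} (hp : Feasible A E γ p) (q : ℕ) :
    CDAchieves A E β γ e q ((1 - ε) * ∑ i, cdInfo A β γ e q p i) := by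
  intro δ hδ
  obtain ⟨p', hp', hpp', hI⟩ := exists_shrink hA hβ hγ hε he hp.1 q (half_pos hδ)
  have he1 : ∀ x, 0 ≤ e x ∧ e x ≤ 1 := fun x => ⟨(he x).1, (he x).2.trans hε.le⟩
  -- Half of `δ` pays for shrinking, half for the back-offs `κ` of all bit-pipes; `N + 1` keeps the
  -- denominator positive for `N = 0`. The threshold exponent lies between the rate and the
  -- information.
  set κ : ℝ := δ / (2 * (N + 1)) with hκ
  have hκ0 : 0 < κ := by positivity
  set R : Fin N → ℝ := fun i => (1 - ε) * cdInfo A β γ e q p' i - κ with hR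
  set θ : Fin N → ℝ := fun i => (1 - ε) * cdInfo A β γ e q p' i - κ / 2 with hθ
  have hlim := tendsto_finsetSum Finset.univ fun (i : Fin N) _ =>
    tendsto_failureBound hA hβ hγ hε he hp' q i (hpp' i) (R := R i) (θ := θ i)
      (by simp only [hR, hθ]; linarith) (by simp only [hθ]; linarith)
  rw [Finset.sum_const_zero] at hlim
  filter_upwards [hlim.eventually (gt_mem_nhds hδ)] with n hn
  have hM : ∀ i, 0 < ⌈(2 : ℝ) ^ (n * R i)⌉₊ := fun i => Nat.ceil_pos.2 (by positivity)
  obtain ⟨C, hC⟩ := exists_thresholdCode_errorProb_le (q := q) hA hβ hγ he1 hp'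
    (L := fun i => condScore (jointLaw A β γ e p') (fun ω => ω.1 i) (cdObs q i)
      (fun o => o 0 ≠ none) (bern (p' i)))
    (fun i x o => condScore_nonneg (jointLaw_nonneg hA hβ hγ he1 hp') (bern_nonneg (hp' i)) x o)
    (fun i o => sum_mul_condScore_le (jointLaw_nonneg hA hβ hγ he1 hp') (bern_nonneg (hp' i))
      (sum_bern _) o) (τ := fun i => (2 : ℝ) ^ (n * θ i)) (fun i => by positivity) hM n p
  -- The codebook is drawn with `p'`, but its weights are capped by `p`.
  refine ⟨_, admissible_thresholdCode hM C hp (fun i hi => ?_) _ _, ?_, hC.trans hn.le⟩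
  · have h0 : p' i = 0 := by
      rcases hpp' i with h | h
      · exact absurd (hp' i).1 (by linarith)
      · exact h.1
    -- On an unused bit-pipe the rate is `-κ`, so the ceiling is exactly 1.
    refine le_antisymm (Nat.ceil_le.2 ?_) (hM i)
    rw [Nat.cast_one]
    refine Real.rpow_le_one_of_one_le_of_nonpos one_le_two
      (mul_nonpos_of_nonneg_of_nonpos n.cast_nonneg ?_)
    simp only [hR, cdInfo_eq_zero hA hβ hγ hε he hp' q h0]
    linarith
  · have hlog : ∀ i, n * R i ≤ Real.logb 2 (⌈(2 : ℝ) ^ (n * R i)⌉₊ : ℝ) := fun i =>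
      (Real.le_logb_iff_rpow_le one_lt_two (Nat.cast_pos.2 (hM i))).2 (Nat.le_ceil _)
    have hNκ : N * κ ≤ δ / 2 := by
      rw [hκ, mul_div_assoc', div_le_div_iff₀ (by positivity) two_pos]
      nlinarith
    calc n * ((1 - ε) * ∑ i, cdInfo A β γ e q p i - δ) ≤ n * ∑ i, R i := by
          refine mul_le_mul_of_nonneg_left ?_ n.cast_nonneg
          simp only [hR, Finset.sum_sub_distrib, ← Finset.mul_sum, Finset.sum_const,
            Finset.card_univ, Fintype.card_fin, nsmul_eq_mul]
          nlinarith
      _ = ∑ i, n * R i := Finset.mul_sum _ _ _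
      _ ≤ _ := Finset.sum_le_sum fun i _ => hlog i

/-! ### Independence of the erasure probabilities above the peak intensity -/

theorem level_le_of_inputProb_ne_zero {p : Fin N → ℝ} (hp : Feasible A E γ p) {x : Fin N → Bool}
    (hx : inputProb p x ≠ 0) : level x ≤ γ * A := by
  refine le_trans ?_ hp.2.1
  rw [level, Finset.sum_filter]
  refine Finset.sum_le_sum fun i _ => ?_
  by_cases hxi : x i = true
  · have : p i ≠ 0 := fun h => hx (by
      rw [inputProb_eq, Finset.prod_eq_zero (Finset.mem_univ i)]
      simp [bern, hxi, h])
    rw [if_pos hxi, if_pos ((hp.1 i).1.lt_of_ne this.symm)]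
  · rw [if_neg hxi]
    split_ifs <;> positivity

theorem cdInfo_congr {e' : (Fin N → Bool) → ℝ} (h : ∀ x, level x ≤ γ * A → e x = e' x)
    {p : Fin N → ℝ} (hp : Feasible A E γ p) (q : ℕ) (i : Fin N) :
    cdInfo A β γ e q p i = cdInfo A β γ e' q p i := by
  have : jointLaw A β γ e p = jointLaw A β γ e' p := by
    funext ω
    unfold jointLaw stateProb
    by_cases hx : inputProb p ω.1 = 0
    · simp [hx]
    · rw [h _ (level_le_of_inputProb_ne_zero hp hx)]
  rw [cdInfo, cdInfo, this]

/-- All words of an admissible code are supported in `V`, so their levels respect the peak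
intensity. -/
theorem errorProb_congr {e' : (Fin N → Bool) → ℝ} (h : ∀ x, level x ≤ γ * A → e x = e' x)
    {q n : ℕ} {c : CDCode N q n} (hc : c.Admissible A E γ) :
    c.errorProb A β γ e = c.errorProb A β γ e' := by
  obtain ⟨⟨V, hV, hoff⟩, -⟩ := hc
  have hlev : ∀ m t, level (c.word m t) ≤ γ * A := fun m t => by
    refine le_trans ?_ hV
    rw [level, ← Finset.sum_filter]
    refine Finset.sum_le_sum_of_subset_of_nonneg (fun i hi => ?_) fun i _ _ => by positivity
    by_contra hiV
    have h1 := (Finset.mem_filter.1 hi).2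
    rw [CDCode.word, (hoff i hiV).2] at h1
    exact Bool.noConfusion h1
  unfold CDCode.errorProb stateProb
  simp only [h _ (hlev _ _)]

end Achieve

end VBC

/-! ### Reduction to erasure probabilities bounded at every input -/

theorem theorem5 (A E β γ : ℝ) (hA : 0 < A) (hE : 0 < E) (hβ : 0 < β) (hγ : 0 < γ)
    (N : ℕ) (hN : (N : ℤ) = ⌈Real.logb 2 (γ * (A + 2 * β))⌉)
    (q : ℕ) (hq : 1 ≤ q) (hqN : q ≤ N - 1)
    (e : (Fin N → Bool) → ℝ)
    (he : ∀ x, VBC.level x ≤ γ * A → 0 ≤ e x ∧ e x ≤ 2 * VBC.gaussQ β) :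
    ∃ r : ℝ,
      IsGreatest ((fun p : Fin N → ℝ => ∑ i, VBC.cdInfo A β γ e q p i) ''
        {p | VBC.Feasible A E γ p}) r ∧
      VBC.CDAchieves A E β γ e q ((1 - 2 * VBC.gaussQ β) * r) := by
  classical
  have hε := VBC.two_mul_gaussQ_lt_one hβ
  have hε0 : 0 ≤ 2 * VBC.gaussQ β := by
    -- The all-zero input always meets the peak constraint, which makes the erasure bound
    -- nonnegative.
    have h := he (fun _ => false) (by simpa [VBC.level] using (mul_pos hγ hA).le)
    exact h.1.trans h.2
  -- Above the peak `e` is unconstrained and need not be a probability; zero is a harmless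
  -- replacement.
  let e' : (Fin N → Bool) → ℝ := fun x => if VBC.level x ≤ γ * A then e x else 0
  have hee' : ∀ x, VBC.level x ≤ γ * A → e x = e' x := fun x hx => by simp [e', hx]
  have he' : ∀ x, 0 ≤ e' x ∧ e' x ≤ 2 * VBC.gaussQ β := fun x => by
    by_cases hx : VBC.level x ≤ γ * A
    · rw [← hee' x hx]
      exact he x hx
    · simpa [e', hx] using hε0
  obtain ⟨p, hp, hmax⟩ := VBC.exists_isGreatest_cdInfo hA hE.le hβ hγ hε he' q
  have hsum : ∀ p', VBC.Feasible A E γ p' →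
      ∑ i, VBC.cdInfo A β γ e q p' i = ∑ i, VBC.cdInfo A β γ e' q p' i := fun p' hp' =>
    Finset.sum_congr rfl fun i _ => VBC.cdInfo_congr hee' hp' q i
  refine ⟨∑ i, VBC.cdInfo A β γ e q p i, ⟨⟨p, hp, rfl⟩, ?_⟩, fun δ hδ => ?_⟩
  · rintro _ ⟨p', hp', rfl⟩
    simp only [hsum p' hp', hsum p hp]
    exact hmax p' hp'
  · rw [hsum p hp]
    filter_upwards [VBC.cdAchieves_of_feasible hA hβ hγ hε0 hε he' hp q δ hδ] with n hn
    obtain ⟨c, hc, hrate, herr⟩ := hn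
    exact ⟨c, hc, hrate, by rwa [VBC.errorProb_congr hee' hc]⟩
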